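/- There is an absolute constant $K$ such that for every $C_1\in\mathbb{N}$ there exist a measurable function $f:\mathbb{R}^2\to\{0,1\}$, constants $C_0,c>0$ and $d_0\in\mathbb{N}$ (depending only on $C_1$) such that the following holds for all real $C_2\ge C_0$ and all integers $d\ge d_0$. Consider the family of Boolean 2-index models \[ \mathcal F=\{\,f_{\mathbf U}(\mathbf x)=f(\mathbf U\mathbf x)\;:\;\mathbf U\in\mathbb{R}^{2\times d},\ \mathbf U\mathbf U^\top=\mathbf I_2\,\},\qquad \mathbf x\sim\mathcal N(\mathbf 0,\mathbf I_d). \] (i) No algorithm that is given only the exact moments of degree at most $C_1$, namely $\mathbf E[\mathbf x^{\alpha}f_{\mathbf U}(\mathbf x)]$ for all $\alpha\in\mathbb{N}^d$ with $|\alpha|\le C_1$, can output a member $f'$ of $\mathcal F$ with $\mathbf E[(f_{\mathbf U}(\mathbf x)-f'(\mathbf x))^2]\le 1/C_2$: for every (possibly randomized) algorithm there is a $\mathbf U$ with $\mathbf U\mathbf U^\top=\mathbf I_2$ for which it succeeds with probability at most $e^{-cd}$; in particular every deterministic algorithm fails on some $\mathbf U$. (ii) There is a deterministic adaptive statistical query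 algorithm that, for every $\varepsilon>0$ and every $\mathbf U$ with $\mathbf U\mathbf U^\top=\mathbf I_2$, makes at most $Kd^2$ queries to the oracle $\mathrm{VSTAT}(C_2d^2/\varepsilon^2)$ for the distribution $D$ of $(\mathbf x,f_{\mathbf U}(\mathbf x))$ and, whatever the valid answers are, outputs $\widehat{\mathbf U}\in\mathbb{R}^{2\times d}$ with $\|\widehat{\mathbf U}-\mathbf U\|_2\le\varepsilon$ (spectral norm). Here a query is a measurable $q:\mathbb{R}^d\times\{0,1\}\to[-1,1]$, and $\mathrm{VSTAT}(u)$ answers it with any value $v$ satisfying $|v-\mathbf E_D[q]|\le\max\bigl(1/u,\sqrt{\mathrm{Var}_D[q]/u}\bigr)$. -/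

import Mathlib

open MeasureTheory ProbabilityTheory Matrix
open scoped Matrix.Norms.L2Operator

noncomputable section

namespace MIM

/-- The standard Gaussian measure `N(0, I)` on `ℝ^d`. -/
def gauss (d : ℕ) : Measure (Fin d → ℝ) :=
  Measure.pi (fun _ => gaussianReal 0 1)

/-- The `2 × d` real matrices `U` with orthonormal rows, i.e. `U Uᵀ = I₂`. -/
abbrev Frame (d : ℕ) : Type :=
  {U : Matrix (Fin 2) (Fin d) ℝ // U * Uᵀ = 1}

/-- The σ-algebra on `Frame d` generated by the matrix entries (its Borel σ-algebra). -/
instance instMeasurableSpaceFrame (d : ℕ) : MeasurableSpace (Frame d) :=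
  MeasurableSpace.comap (fun (U : Frame d) (i : Fin 2) (j : Fin d) => U.1 i j) MeasurableSpace.pi

/-- The Boolean 2-index model `x ↦ f (U x)`.  For a fixed link function `f`, these functions with
`U` ranging over `Frame d` form the family attached to `f`. -/
def model {d : ℕ} (f : (Fin 2 → ℝ) → Bool) (U : Frame d) (x : Fin d → ℝ) : Bool :=
  f (U.1 *ᵥ x)

/-- The real value `0` or `1` of a Boolean label. -/
def label (b : Bool) : ℝ := if b then 1 else 0

/-- A table of real numbers indexed by the multi-indices `α ∈ ℕ^d` of total degree at most `m`. -/
abbrev MomentTable (d m : ℕ) : Type :=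
  {α : Fin d → ℕ // ∑ i, α i ≤ m} → ℝ

/-- The exact moments `E[x^α g(x)]`, `|α| ≤ m`, of a Boolean function `g` under `x ∼ N(0, I)`.
(As `g` takes the values `0` and `1` only, higher powers of `g` give nothing new.) -/
def moments {d : ℕ} (m : ℕ) (g : (Fin d → ℝ) → Bool) : MomentTable d m :=
  fun α => ∫ x, (∏ i, x i ^ α.1 i) * label (g x) ∂(gauss d)

/-- The squared `L²` distance `E[(g(x) - h(x))²]` of two Boolean functions under `x ∼ N(0, I)`. -/
def sqError {d : ℕ} (g h : (Fin d → ℝ) → Bool) : ℝ :=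
  ∫ x, (label (g x) - label (h x)) ^ 2 ∂(gauss d)

/-- The joint law on `ℝ^d × {0,1}` of `(x, g(x))` with `x ∼ N(0, I)`. -/
def labelledLaw {d : ℕ} (g : (Fin d → ℝ) → Bool) : Measure ((Fin d → ℝ) × Bool) :=
  (gauss d).map (fun x => (x, g x))

/-- A statistical query: a measurable function with values in `[-1, 1]`. -/
structure Query (X : Type*) [MeasurableSpace X] where
  toFun : X → ℝ
  measurable : Measurable toFun
  bounded : ∀ x, toFun x ∈ Set.Icc (-1 : ℝ) 1

/-- `v` is an admissible answer of the oracle `VSTAT(u)` for `D` to the query `q`: it is within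
`max (1/u) (√(Var_D[q]/u))` of `E_D[q]`. -/
def IsVSTATAnswer {X : Type*} [MeasurableSpace X] (D : Measure X) (u : ℝ) (q : Query X)
    (v : ℝ) : Prop :=
  |v - ∫ x, q.toFun x ∂D| ≤ max (1 / u) (Real.sqrt (variance q.toFun D / u))

/-- An adaptive statistical query algorithm making `n` queries: the `i`-th query is a function of
the answers to the earlier ones, and the output is a function of all the answers. -/
structure SQAlgorithm (X : Type*) [MeasurableSpace X] (β : Type*) (n : ℕ) where
  ask : (i : Fin n) → (Fin i → ℝ) → Query X
  output : (Fin n → ℝ) → β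

/-- `a` is a possible list of answers received by `A` when it interacts with `VSTAT(u)` for `D`. -/
def SQAlgorithm.IsTranscript {X β : Type*} [MeasurableSpace X] {n : ℕ} (A : SQAlgorithm X β n)
    (D : Measure X) (u : ℝ) (a : Fin n → ℝ) : Prop :=
  ∀ i : Fin n, IsVSTATAnswer D u (A.ask i (fun j => a ⟨j, j.2.trans i.2⟩)) (a i)

end MIM

end

namespace MIM

/-! The link is built from a function `σ` of one variable with values in {0, 1, -1} whose Gaussian
moments up to degree `C₁ + 1` all vanish. Its label is (|σ(z₀)| + σ(z₀) sgn z₁)/2, so the second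
direction enters only through a factor σ(z₀). Such a `σ` is a signed sum of short disjoint
intervals; the inverse function principle, with a Vandermonde Jacobian, makes its moments cancel
(`exists_sign_orthogonal`).

Hardness: fix the first row to be e₀ and let the second be a normalized sign vector orthogonal to
it. By independence of x₀ and the other coordinates, every moment of degree at most `C₁` of the
σ·sgn term vanishes, so all 2^(d-1) frames have the same moment table (`moments_signFrame`). The
algorithm therefore has one output law for all of them. Two models in this family close to a common
output have sign vectors differing in at most a quarter of the places (`four_mul_card_symmDiff_le`).
Such Hamming balls are an exponentially small part of the cube, and averaging over the cube finds a
frame on which success is exponentially unlikely.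

Learning: E[label · x] is a positive multiple of the first row. Once that row is known
approximately, a Lipschitz weight `w` in its direction breaks the cancellation: E[label · w(u·x) ·
x] is a combination of both rows with positive coefficient on the second (`secondCorr_pos`). Each
expectation takes `d` truncated coordinate queries, 2d in all. The adaptivity is essential to this
scheme, since `w` has to be evaluated along the direction learnt in the first stage. -/

instance isProbabilityMeasure_gauss (d : ℕ) : IsProbabilityMeasure (gauss d) := by
  unfold gauss; infer_instance

/-! ### Invariance of the Gaussian measure -/

theorem charFunDual_gauss {d : ℕ} (L : StrongDual ℝ (Fin d → ℝ)) :
    charFunDual (gauss d) L =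
      Complex.exp (-((∑ i, L (Pi.single i 1) ^ 2 : ℝ) : ℂ) / 2) := by
  have h (i : Fin d) : charFunDual (gaussianReal 0 1) (L.comp (.single ℝ (fun _ => ℝ) i)) =
      Complex.exp (-((L (Pi.single i 1) ^ 2 : ℝ) : ℂ) / 2) := by
    obtain ⟨c, hc⟩ : ∃ c, ∀ x : ℝ, L (Pi.single i x) = c * x := by
      refine ⟨L (Pi.single i 1), fun x => ?_⟩
      rw [show (Pi.single i x : Fin d → ℝ) = x • Pi.single i 1 by
        rw [← Pi.single_smul]; simp, map_smul, smul_eq_mul, mul_comm]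
    have h1 := charFun_gaussianReal (μ := 0) (v := 1) c
    rw [charFun_apply_real] at h1
    rw [charFunDual_apply]
    simp only [ContinuousLinearMap.comp_apply, ContinuousLinearMap.single_apply, hc, mul_one]
    push_cast
    rw [h1]
    congr 1
    simp [neg_div]
  rw [gauss, charFunDual_pi]
  simp_rw [h]
  rw [← Complex.exp_sum]
  congr 1
  push_cast
  rw [← Finset.sum_div, Finset.sum_neg_distrib]

/-- The characteristic function sees a functional only through the squared length of its coefficient
vector `a`, and `M * Mᵀ = 1` gives |aM| = |a|. Rectangular `M` is allowed, so this covers both the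
projection by a frame and the reflections used below. -/
theorem gauss_map_mulVec {n k : ℕ} (M : Matrix (Fin n) (Fin k) ℝ) (hM : M * Mᵀ = 1) :
    (gauss k).map (fun x => M *ᵥ x) = gauss n := by
  have hf : (fun x => M *ᵥ x) = ⇑(LinearMap.toContinuousLinearMap (Matrix.mulVecLin M)) := by
    ext; simp
  have : IsProbabilityMeasure
      ((gauss k).map ⇑(LinearMap.toContinuousLinearMap (Matrix.mulVecLin M))) :=
    Measure.isProbabilityMeasure_map (Continuous.aemeasurable (by fun_prop))
  rw [hf]
  apply Measure.ext_of_charFunDual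
  ext L
  rw [charFunDual_map, charFunDual_gauss, charFunDual_gauss]
  congr 4
  set a : Fin n → ℝ := fun i => L (Pi.single i 1) with ha
  have hL (v : Fin n → ℝ) : L v = a ⬝ᵥ v := by
    conv_lhs => rw [← Finset.univ_sum_single v]
    rw [map_sum]
    refine Finset.sum_congr rfl fun i _ => ?_
    rw [show (Pi.single i (v i) : Fin n → ℝ) = v i • Pi.single i 1 by
        rw [← Pi.single_smul]; simp, map_smul, smul_eq_mul, mul_comm]
  have h1 (j : Fin k) : (L.comp (LinearMap.toContinuousLinearMap (Matrix.mulVecLin M)))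
      (Pi.single j 1) = (a ᵥ* M) j := by
    simp [hL, Matrix.vecMul, dotProduct, Matrix.col_apply]
  simp_rw [h1]
  have h2 (m : ℕ) (v : Fin m → ℝ) : ∑ i, v i ^ 2 = v ⬝ᵥ v := by
    simp [dotProduct, sq]
  rw [h2, h2 n a, ← Matrix.mulVec_transpose, Matrix.dotProduct_mulVec, Matrix.vecMul_transpose,
    Matrix.mulVec_mulVec, hM, Matrix.one_mulVec]

theorem integral_gauss_mulVec {n k : ℕ} (M : Matrix (Fin n) (Fin k) ℝ) (hM : M * Mᵀ = 1)
    {g : (Fin n → ℝ) → ℝ} (hg : Measurable g) :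
    ∫ x, g (M *ᵥ x) ∂(gauss k) = ∫ z, g z ∂(gauss n) := by
  rw [← gauss_map_mulVec M hM, integral_map]
  · exact Continuous.aemeasurable (by fun_prop)
  · exact hg.aestronglyMeasurable

/-! ### Integrals of products and second moments -/

theorem integral_gauss_two (g h : ℝ → ℝ) :
    ∫ z, g (z 0) * h (z 1) ∂(gauss 2) =
      (∫ s, g s ∂(gaussianReal 0 1)) * ∫ s, h s ∂(gaussianReal 0 1) := by
  have := integral_fintype_prod_eq_prod (𝕜 := ℝ) (ι := Fin 2) (E := fun _ => ℝ)
    (μ := fun _ => gaussianReal 0 1) ![g, h]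
  simpa [Fin.prod_univ_two, gauss] using this

theorem integrable_gauss_two {g h : ℝ → ℝ} (hg : Integrable g (gaussianReal 0 1))
    (hh : Integrable h (gaussianReal 0 1)) :
    Integrable (fun z => g (z 0) * h (z 1)) (gauss 2) := by
  have := Integrable.fintype_prod (𝕜 := ℝ) (ι := Fin 2) (E := ℝ)
    (μ := fun _ => gaussianReal 0 1) (f := ![g, h])
    (by intro i; fin_cases i <;> simpa)
  simpa [Fin.prod_univ_two, gauss] using this

theorem memLp_two_eval_gauss {d : ℕ} (i : Fin d) : MemLp (fun x : Fin d → ℝ => x i) 2 (gauss d) :=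
  (memLp_id_gaussianReal 2).comp_measurePreserving
    (measurePreserving_eval (fun _ : Fin d => gaussianReal 0 1) i)

theorem memLp_two_dotProduct_gauss {d : ℕ} (a : Fin d → ℝ) :
    MemLp (fun x => a ⬝ᵥ x) 2 (gauss d) := by
  simp only [dotProduct]
  exact memLp_finsetSum _ fun i _ => (memLp_two_eval_gauss i).const_mul (a i)

theorem integral_dotProduct_sq_gauss {d : ℕ} (a : Fin d → ℝ) :
    ∫ x, (a ⬝ᵥ x) ^ 2 ∂(gauss d) = ∑ i, a i ^ 2 := by
  have h1 (i : Fin d) : ∫ x, x i ∂(gauss d) = 0 := by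
    have := (measurePreserving_eval (fun _ : Fin d => gaussianReal 0 1) i).map_eq
    have h := integral_id_gaussianReal (μ := 0) (v := 1)
    rw [← this, integral_map (measurable_pi_apply i).aemeasurable (by fun_prop)] at h
    exact h
  have h2 : ∫ x, a ⬝ᵥ x ∂(gauss d) = 0 := by
    simp only [dotProduct]
    rw [integral_finsetSum _ fun i _ =>
      ((memLp_two_eval_gauss i).integrable (by norm_num)).const_mul (a i)]
    simp [integral_const_mul, h1]
  have h3 := variance_of_integral_eq_zero
    (memLp_two_dotProduct_gauss a).aestronglyMeasurable.aemeasurable h2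
  rw [← h3]
  have h4 := variance_sum_pi (μ := fun _ : Fin d => gaussianReal 0 1)
    (X := fun i s => a i * s) fun i => (memLp_id_gaussianReal 2).const_mul (a i)
  have h5 : (∑ i, fun ω : Fin d → ℝ => a i * ω i) = fun x => a ⬝ᵥ x := by
    ext x; simp [dotProduct]
  rw [h5] at h4
  have h6 : Var[fun s : ℝ => s; gaussianReal 0 1] = 1 := by simp
  rw [gauss, h4]
  refine Finset.sum_congr rfl fun i _ => ?_
  rw [variance_const_mul, h6, mul_one]

theorem integral_eval_sq_gauss {d : ℕ} (i : Fin d) : ∫ x, x i ^ 2 ∂(gauss d) = 1 := by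
  have := integral_dotProduct_sq_gauss (Pi.single i (1 : ℝ))
  simpa [Pi.single_apply] using this

/-! ### A sign function orthogonal to all polynomials of bounded degree -/

/-- The oriented indicator function of the interval with end points `p` and `p + l`. -/
noncomputable def orientedIndicator (p l s : ℝ) : ℝ :=
  (Set.Ioc p (p + l)).indicator 1 s - (Set.Ioc (p + l) p).indicator 1 s

theorem measurable_orientedIndicator (p l : ℝ) : Measurable (orientedIndicator p l) :=
  (measurable_one.indicator measurableSet_Ioc).sub (measurable_one.indicator measurableSet_Ioc)

theorem orientedIndicator_mem (p l s : ℝ) :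
    orientedIndicator p l s = 0 ∨ orientedIndicator p l s = 1 ∨ orientedIndicator p l s = -1 := by
  unfold orientedIndicator
  by_cases h1 : s ∈ Set.Ioc p (p + l) <;> by_cases h2 : s ∈ Set.Ioc (p + l) p
  · exact absurd h1.1 (not_lt.2 h2.2)
  all_goals simp [h1, h2]

theorem abs_sub_lt_of_orientedIndicator_ne_zero {p l s : ℝ} (hl : |l| < 1)
    (h : orientedIndicator p l s ≠ 0) : |s - p| < 1 := by
  rw [abs_lt] at hl ⊢
  unfold orientedIndicator at h
  by_cases h1 : s ∈ Set.Ioc p (p + l)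
  · exact ⟨by linarith [h1.1], by linarith [h1.2]⟩
  by_cases h2 : s ∈ Set.Ioc (p + l) p
  · exact ⟨by linarith [h2.1], by linarith [h2.2]⟩
  simp [h1, h2] at h

theorem integral_mul_orientedIndicator (p l : ℝ) (g : ℝ → ℝ) (hg : Continuous g) :
    Integrable (fun s => g s * orientedIndicator p l s) ∧
      ∫ s, g s * orientedIndicator p l s = ∫ s in p..(p + l), g s := by
  have h (a b : ℝ) : (fun s => g s * (Set.Ioc a b).indicator 1 s) = (Set.Ioc a b).indicator g := by
    ext s
    by_cases hs : s ∈ Set.Ioc a b <;> simp [hs]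
  have hi (a b : ℝ) : Integrable ((Set.Ioc a b).indicator g) :=
    (integrable_indicator_iff measurableSet_Ioc).2 hg.integrableOn_Ioc
  have e : (fun s => g s * orientedIndicator p l s) = fun s =>
      (Set.Ioc p (p + l)).indicator g s - (Set.Ioc (p + l) p).indicator g s := by
    rw [← h, ← h]
    ext s
    simp [orientedIndicator, mul_sub]
  rw [e, intervalIntegral]
  refine ⟨(hi _ _).sub (hi _ _), ?_⟩
  rw [integral_sub (hi _ _) (hi _ _), integral_indicator measurableSet_Ioc,
    integral_indicator measurableSet_Ioc]

/-- Oriented intervals starting at given distinct points can be chosen arbitrarily short, the last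
one nondegenerate, so that their moments up to order `m` cancel. -/
theorem exists_lengths_moments_eq_zero (m : ℕ) (φ : ℝ → ℝ) (hφ : Continuous φ)
    (hpos : ∀ s, 0 < φ s) (p : Fin (m + 1) → ℝ) (hp : Function.Injective p) (q : ℝ) :
    ∃ l : Fin (m + 1) → ℝ, ∃ t : ℝ, (∀ j, |l j| < 1) ∧ 0 < t ∧ t < 1 ∧
      ∀ a : Fin (m + 1), ∑ j, (∫ s in (p j)..(p j + l j), s ^ (a : ℕ) * φ s) +
        ∫ s in q..(q + t), s ^ (a : ℕ) * φ s = 0 := by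
  set g : Fin (m + 1) → ℝ → ℝ := fun a s => s ^ (a : ℕ) * φ s with hgdef
  have hg (a) : Continuous (g a) := by fun_prop
  set F : (Fin (m + 1) → ℝ) → Fin (m + 1) → ℝ :=
    fun l a => ∑ j, ∫ s in (p j)..(p j + l j), g a s with hF
  set A : Matrix (Fin (m + 1)) (Fin (m + 1)) ℝ := fun a j => g a (p j) with hA
  -- `A` is the Jacobian of the moment map `F` at zero lengths: a transposed Vandermonde matrix with
  -- columns scaled by the positive density values.
  have hdet : A.det ≠ 0 := by
    have : A = (Matrix.vandermonde p)ᵀ * Matrix.diagonal (fun j => φ (p j)) := by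
      ext a j
      simp [hA, hgdef, Matrix.vandermonde_apply]
    rw [this, Matrix.det_mul, Matrix.det_transpose, Matrix.det_diagonal]
    exact mul_ne_zero (Matrix.det_vandermonde_ne_zero_iff.2 hp)
      (Finset.prod_ne_zero_iff.2 fun j _ => (hpos _).ne')
  have hder : HasStrictFDerivAt F (LinearMap.toContinuousLinearMap A.mulVecLin) 0 := by
    rw [hasStrictFDerivAt_pi']
    intro a
    have h1 (j : Fin (m + 1)) : HasStrictFDerivAt
        (fun l : Fin (m + 1) → ℝ => ∫ s in (p j)..(p j + l j), g a s)
        (A a j • ContinuousLinearMap.proj (R := ℝ) (φ := fun _ : Fin (m + 1) => ℝ) j) 0 := by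
      have h2 : HasStrictDerivAt (fun u => ∫ s in (p j)..u, g a s) (g a (p j))
          (p j + (0 : Fin (m + 1) → ℝ) j) := by
        simpa using (hg a).integral_hasStrictDerivAt (p j) (p j)
      have h3 : HasStrictFDerivAt (fun l : Fin (m + 1) → ℝ => p j + l j)
          (ContinuousLinearMap.proj (R := ℝ) (φ := fun _ : Fin (m + 1) => ℝ) j) 0 :=
        (ContinuousLinearMap.proj (R := ℝ) (φ := fun _ : Fin (m + 1) => ℝ)
          j).hasStrictFDerivAt.const_add (p j)
      exact h2.comp_hasStrictFDerivAt (0 : Fin (m + 1) → ℝ) h3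
    have h4 := HasStrictFDerivAt.fun_sum (u := Finset.univ) fun j _ => h1 j
    convert h4 using 1
    ext l
    simp [Matrix.mulVec, dotProduct]
  have hrange : (LinearMap.toContinuousLinearMap A.mulVecLin).range = ⊤ := by
    rw [LinearMap.range_eq_top]
    exact Matrix.mulVec_surjective_iff_isUnit.2 ((Matrix.isUnit_iff_isUnit_det A).2 hdet.isUnit)
  -- A surjective strict derivative makes `F` open at 0, so short lengths reach every small moment
  -- vector, in particular `G t`, which cancels the last interval, for small `t > 0`.
  have hmap := hder.map_nhds_eq_of_surj hrange
  have hF0 : F 0 = 0 := by ext a; simp [hF]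
  rw [hF0] at hmap
  have hS : {l : Fin (m + 1) → ℝ | ∀ j, |l j| < 1} ∈ nhds (0 : Fin (m + 1) → ℝ) := by
    have : IsOpen {l : Fin (m + 1) → ℝ | ∀ j, |l j| < 1} := by
      simp only [Set.ofPred_forall]
      exact isOpen_iInter_of_finite fun j => isOpen_lt (by fun_prop) continuous_const
    exact this.mem_nhds (by simp)
  have himg : F '' {l : Fin (m + 1) → ℝ | ∀ j, |l j| < 1} ∈ nhds (0 : Fin (m + 1) → ℝ) := by
    rw [← hmap]
    exact Filter.image_mem_map hS
  set G : ℝ → Fin (m + 1) → ℝ := fun t a => -∫ s in q..(q + t), g a s with hG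
  have hGc : Continuous G := by
    refine continuous_pi fun a => Continuous.neg ?_
    have := intervalIntegral.continuous_primitive (μ := volume)
      (fun a' b' => (hg a).intervalIntegrable a' b') q
    exact this.comp (by fun_prop : Continuous fun t : ℝ => q + t)
  have hG0 : G 0 = 0 := by ext a; simp [hG]
  have hev : ∀ᶠ t in nhds (0 : ℝ), G t ∈ F '' {l : Fin (m + 1) → ℝ | ∀ j, |l j| < 1} :=
    hGc.continuousAt.eventually (by rw [hG0]; exact himg)
  obtain ⟨δ, hδ, hball⟩ := Metric.eventually_nhds_iff.1 hev
  have ht : dist (min (δ / 2) (1 / 2)) 0 < δ := by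
    rw [Real.dist_eq, sub_zero, abs_of_pos (by positivity)]
    exact (min_le_left _ _).trans_lt (by linarith)
  obtain ⟨l, hl, hlG⟩ := hball ht
  refine ⟨l, min (δ / 2) (1 / 2), hl, by positivity,
    (min_le_right _ _).trans_lt (by norm_num), fun a => ?_⟩
  have := congrFun hlG a
  simp only [hF, hG] at this
  rw [this, neg_add_cancel]

/-- There are `m + 1` intervals to solve the moment equations and one extra to keep the solution
nonzero. The weight is a tent on the extra interval, where σ = 1, so that wσ = w has positive
integral. -/
theorem exists_sign_orthogonal (m : ℕ) :
    ∃ σ : ℝ → ℝ, Measurable σ ∧ (∀ s, σ s = 0 ∨ σ s = 1 ∨ σ s = -1) ∧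
      (∀ s, σ s ≠ 0 → 1 ≤ s) ∧ (∀ a ≤ m, ∫ s, s ^ a * σ s ∂(gaussianReal 0 1) = 0) ∧
      ∃ w : ℝ → ℝ, (∀ s, 0 ≤ w s) ∧ (∀ s, w s ≤ 1) ∧ (∀ s t, |w s - w t| ≤ |s - t|) ∧
        0 < ∫ s, w s * σ s ∂(gaussianReal 0 1) := by
  set φ := gaussianPDFReal 0 1 with hφ
  have hφc : Continuous φ := by
    rw [hφ, gaussianPDFReal_def]; fun_prop
  -- Spacing 2 with lengths below 1 makes the intervals disjoint, so the sum keeps values in {0, 1,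
  -- -1}; starting at 2 keeps the support to the right of 1.
  set P : Fin (m + 1 + 1) → ℝ := fun j => 2 * ((j : ℝ) + 1) with hP
  have hPinj {j k : Fin (m + 1 + 1)} (hjk : |P j - P k| < 2) : j = k := by
    rw [abs_lt] at hjk
    simp only [hP] at hjk
    have h1 : (j : ℝ) < (k : ℝ) + 1 := by linarith [hjk.2]
    have h2 : (k : ℝ) < (j : ℝ) + 1 := by linarith [hjk.1]
    have h1' : (j : ℕ) < (k : ℕ) + 1 := by exact_mod_cast h1
    have h2' : (k : ℕ) < (j : ℕ) + 1 := by exact_mod_cast h2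
    ext; omega
  obtain ⟨l, t, hl, ht0, ht1, hzero⟩ := exists_lengths_moments_eq_zero m φ hφc
    (fun s => gaussianPDFReal_pos 0 1 s one_ne_zero) (fun j => P j.castSucc)
    (fun j k hjk => Fin.castSucc_injective _ (hPinj (by simp [show P j.castSucc = P k.castSucc
      from hjk]))) (P (Fin.last _))
  set L : Fin (m + 1 + 1) → ℝ := Fin.snoc (α := fun _ => ℝ) l t with hL
  have hL1 (j) : |L j| < 1 := by
    refine Fin.lastCases ?_ (fun j => ?_) j
    · simpa [hL, abs_of_pos ht0] using ht1
    · simpa [hL] using hl j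
  set σ : ℝ → ℝ := fun s => ∑ j, orientedIndicator (P j) (L j) s with hσ
  have hσval {s : ℝ} {j} (h : orientedIndicator (P j) (L j) s ≠ 0) :
      σ s = orientedIndicator (P j) (L j) s := by
    refine Finset.sum_eq_single j (fun k _ hkj => ?_) (by simp)
    by_contra hk
    have h1 := abs_sub_lt_of_orientedIndicator_ne_zero (hL1 j) h
    have h2 := abs_sub_lt_of_orientedIndicator_ne_zero (hL1 k) hk
    refine hkj (hPinj ?_)
    rw [abs_lt] at *
    exact ⟨by linarith [h1.1, h2.2], by linarith [h1.2, h2.1]⟩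
  have hσne {s : ℝ} (h : σ s ≠ 0) : ∃ j, orientedIndicator (P j) (L j) s ≠ 0 := by
    by_contra! hcon
    exact h (Finset.sum_eq_zero fun j _ => hcon j)
  refine ⟨σ, Finset.measurable_sum _ fun j _ => measurable_orientedIndicator _ _, fun s => ?_,
    fun s hs => ?_, fun a ha => ?_, ?_⟩
  · by_cases h : σ s = 0
    · exact Or.inl h
    · obtain ⟨j, hj⟩ := hσne h
      rw [hσval hj]
      exact orientedIndicator_mem _ _ _
  · obtain ⟨j, hj⟩ := hσne hs
    have h1 := abs_sub_lt_of_orientedIndicator_ne_zero (hL1 j) hj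
    rw [abs_lt] at h1
    have h2 : (2 : ℝ) ≤ P j := by
      simp only [hP]; linarith [(Nat.cast_nonneg (j : ℕ) : (0 : ℝ) ≤ ((j : ℕ) : ℝ))]
    linarith [h1.1]
  · rw [integral_gaussianReal_eq_integral_smul one_ne_zero]
    have h1 (j) := integral_mul_orientedIndicator (P j) (L j) (fun s => s ^ a * φ s) (by fun_prop)
    have h2 : (fun s => gaussianPDFReal 0 1 s • (s ^ a * σ s)) =
        fun s => ∑ j, s ^ a * φ s * orientedIndicator (P j) (L j) s := by
      ext s
      rw [← Finset.mul_sum, smul_eq_mul]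
      ring
    rw [h2, integral_finsetSum _ fun j _ => (h1 j).1]
    simp_rw [fun j => (h1 j).2]
    rw [Fin.sum_univ_castSucc]
    simpa [hL] using hzero ⟨a, by omega⟩
  · set q := P (Fin.last (m + 1)) with hq
    set w : ℝ → ℝ := fun s => max 0 (min (s - q) (q + t - s)) with hw
    have hwc : Continuous w := by fun_prop
    have hw0 (s) : 0 ≤ w s := le_max_left _ _
    have hw1 (s) : w s ≤ 1 := by
      refine max_le zero_le_one ?_
      rcases le_total s (q + 1) with h | h
      · exact (min_le_left _ _).trans (by linarith)
      · exact (min_le_right _ _).trans (by linarith)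
    refine ⟨w, hw0, hw1, fun s u => ?_, ?_⟩
    · refine (abs_max_sub_max_le_max _ _ _ _).trans (max_le (by simp) ?_)
      refine (abs_min_sub_min_le_max _ _ _ _).trans (max_le ?_ ?_)
      · rw [sub_sub_sub_cancel_right]
      · rw [sub_sub_sub_cancel_left, abs_sub_comm]
    · have hwσ (s) : w s * σ s = w s := by
        by_cases h : s ∈ Set.Ioo q (q + t)
        · have h1 : orientedIndicator (P (Fin.last (m + 1))) (L (Fin.last (m + 1))) s = 1 := by
            have e1 : s ∈ Set.Ioc q (q + t) := ⟨h.1, h.2.le⟩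
            have e2 : s ∉ Set.Ioc (q + t) q := fun hs => absurd h.1 (not_lt.2 hs.2)
            simp [orientedIndicator, hL, ← hq, e1, e2]
          rw [hσval (by rw [h1]; exact one_ne_zero), h1, mul_one]
        · have : w s = 0 := by
            refine max_eq_left ?_
            rcases le_or_gt s q with h' | h'
            · exact (min_le_left _ _).trans (by linarith)
            · have : q + t ≤ s := not_lt.1 fun h'' => h ⟨h', h''⟩
              exact (min_le_right _ _).trans (by linarith)
          rw [this, zero_mul]
      simp_rw [hwσ]
      have hint : Integrable w (gaussianReal 0 1) :=
        Integrable.of_bound hwc.aestronglyMeasurable 1 (Filter.Eventually.of_forall fun s => by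
          rw [Real.norm_eq_abs, abs_of_nonneg (hw0 s)]; exact hw1 s)
      rw [integral_pos_iff_support_of_nonneg hw0 hint, pos_iff_ne_zero]
      intro h0
      have h1 := gaussianReal_absolutelyContinuous' 0 one_ne_zero h0
      have h2 : Set.Ioo q (q + t) ⊆ Function.support w := fun s hs =>
        (lt_max_of_lt_right (lt_min (by linarith [hs.1]) (by linarith [hs.2]))).ne'
      have h3 := measure_mono_null h2 h1
      rw [Real.volume_Ioo] at h3
      simp at h3
      linarith

/-! ### The link function -/

/-- A sign function with vanishing Gaussian moments up to degree `m`, together with a Lipschitz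
weight that detects it. -/
structure SignProfile (m : ℕ) where
  σ : ℝ → ℝ
  w : ℝ → ℝ
  measurable_σ : Measurable σ
  σ_mem : ∀ s, σ s = 0 ∨ σ s = 1 ∨ σ s = -1
  one_le_of_σ_ne_zero : ∀ s, σ s ≠ 0 → 1 ≤ s
  integral_pow_mul_σ : ∀ a ≤ m, ∫ s, s ^ a * σ s ∂(gaussianReal 0 1) = 0
  w_nonneg : ∀ s, 0 ≤ w s
  w_le_one : ∀ s, w s ≤ 1
  w_lipschitz : ∀ s t, |w s - w t| ≤ |s - t|
  integral_w_mul_σ_pos : 0 < ∫ s, w s * σ s ∂(gaussianReal 0 1)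

theorem nonempty_signProfile (m : ℕ) : Nonempty (SignProfile m) := by
  obtain ⟨σ, h1, h2, h3, h4, w, h5, h6, h7, h8⟩ := exists_sign_orthogonal m
  exact ⟨⟨σ, w, h1, h2, h3, h4, h5, h6, h7, h8⟩⟩

/-- The sign of a real number, with the value `-1` at `0`. -/
noncomputable def leftSign (s : ℝ) : ℝ := if 0 < s then 1 else -1

theorem measurable_leftSign : Measurable leftSign :=
  Measurable.ite measurableSet_Ioi measurable_const measurable_const

theorem leftSign_mul_self (s : ℝ) : leftSign s * s = |s| := by
  unfold leftSign
  split_ifs with h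
  · rw [abs_of_pos h, one_mul]
  · rw [abs_of_nonpos (not_lt.1 h), neg_one_mul]

theorem abs_leftSign (s : ℝ) : |leftSign s| = 1 := by
  unfold leftSign
  split_ifs <;> simp

theorem label_nonneg (b : Bool) : 0 ≤ label b := by cases b <;> simp [label]

theorem label_le_one (b : Bool) : label b ≤ 1 := by cases b <;> simp [label]

theorem measurable_label : Measurable label := measurable_of_finite _

theorem integrable_id_gauss : Integrable (fun s : ℝ => s) (gaussianReal 0 1) :=
  (memLp_id_gaussianReal 2).integrable (by norm_num)

theorem integrable_leftSign_mul_self :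
    Integrable (fun s : ℝ => leftSign s * s) (gaussianReal 0 1) := by
  simp_rw [leftSign_mul_self]
  exact integrable_id_gauss.abs

namespace SignProfile

variable {m : ℕ} (P : SignProfile m)

/-- The Boolean link function of a sign profile. -/
noncomputable def link (z : Fin 2 → ℝ) : Bool :=
  open Classical in decide ((P.σ (z 0) = 1 ∧ 0 < z 1) ∨ (P.σ (z 0) = -1 ∧ z 1 ≤ 0))

theorem measurable_link : Measurable P.link := by
  refine measurable_to_bool ?_
  have : P.link ⁻¹' {true} = {z | (P.σ (z 0) = 1 ∧ 0 < z 1) ∨ (P.σ (z 0) = -1 ∧ z 1 ≤ 0)} := by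
    ext z; simp [link]
  rw [this]
  have h0 : Measurable fun z : Fin 2 → ℝ => P.σ (z 0) :=
    P.measurable_σ.comp (measurable_pi_apply 0)
  have h1 : Measurable fun z : Fin 2 → ℝ => z 1 := measurable_pi_apply 1
  exact ((h0 (measurableSet_singleton 1)).inter (h1 measurableSet_Ioi)).union
    ((h0 (measurableSet_singleton (-1))).inter (h1 measurableSet_Iic))

/-- Writing the label as products of one-variable functions lets all Gaussian integrals of it
factor. -/
theorem label_link (z : Fin 2 → ℝ) :
    label (P.link z) = (|P.σ (z 0)| + P.σ (z 0) * leftSign (z 1)) / 2 := by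
  unfold link leftSign label
  have h1 : ¬ (1 : ℝ) = -1 := by norm_num
  have h2 : ¬ (-1 : ℝ) = 1 := by norm_num
  by_cases hz : 0 < z 1 <;> have hz' := hz <;> rw [← not_le] at hz' <;>
    rcases P.σ_mem (z 0) with h | h | h <;> simp [h, hz, h1, h2, not_lt.1, hz']

theorem continuous_w : Continuous P.w :=
  (LipschitzWith.of_dist_le_mul (K := 1) fun s t => by
    simpa [Real.dist_eq] using P.w_lipschitz s t).continuous

theorem abs_σ_le (s : ℝ) : |P.σ s| ≤ 1 := by
  rcases P.σ_mem s with h | h | h <;> simp [h]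

theorem integrable_w_mul_σ : Integrable (fun s => P.w s * P.σ s) (gaussianReal 0 1) :=
  Integrable.of_bound (P.continuous_w.measurable.mul P.measurable_σ).aestronglyMeasurable 1
    (Filter.Eventually.of_forall fun s => by
      rw [norm_mul, Real.norm_eq_abs, Real.norm_eq_abs, abs_of_nonneg (P.w_nonneg s)]
      exact mul_le_one₀ (P.w_le_one s) (abs_nonneg _) (P.abs_σ_le s))

/-- The |σ| part is multiplied by the mean of z₁, which is 0; only the σ·sgn part survives. With g =
1 the result vanishes, with g = w it does not. -/
theorem integral_label_mul_eval_one {g : ℝ → ℝ} (hg : Measurable g) (hg1 : ∀ s, |g s| ≤ 1) :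
    ∫ z, label (P.link z) * g (z 0) * z 1 ∂(gauss 2) =
      (∫ s, g s * P.σ s ∂(gaussianReal 0 1)) * (∫ s, |s| ∂(gaussianReal 0 1)) / 2 := by
  have e : (fun z : Fin 2 → ℝ => label (P.link z) * g (z 0) * z 1) = fun z =>
      (g (z 0) * |P.σ (z 0)| / 2) * z 1 + (g (z 0) * P.σ (z 0)) * (leftSign (z 1) * z 1 / 2) := by
    ext z
    rw [P.label_link]
    ring
  have hb (s : ℝ) : |g s * P.σ s| ≤ 1 := by
    rw [abs_mul]; exact mul_le_one₀ (hg1 s) (abs_nonneg _) (P.abs_σ_le s)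
  have i1 : Integrable (fun s => g s * P.σ s) (gaussianReal 0 1) :=
    Integrable.of_bound (hg.mul P.measurable_σ).aestronglyMeasurable 1
      (Filter.Eventually.of_forall hb)
  have i2 : Integrable (fun s => g s * |P.σ s| / 2) (gaussianReal 0 1) :=
    (Integrable.of_bound (hg.mul P.measurable_σ.abs).aestronglyMeasurable 1
      (Filter.Eventually.of_forall fun s => by
        change abs (g s * abs (P.σ s)) ≤ 1
        rw [abs_mul, abs_abs, ← abs_mul]
        exact hb s)).div_const 2
  rw [e, integral_add (integrable_gauss_two i2 integrable_id_gauss)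
    (integrable_gauss_two i1 (integrable_leftSign_mul_self.div_const 2)),
    integral_gauss_two (fun s => g s * |P.σ s| / 2) (fun s => s),
    integral_gauss_two (fun s => g s * P.σ s) (fun s => leftSign s * s / 2),
    integral_id_gaussianReal, mul_zero, zero_add, integral_div]
  simp_rw [leftSign_mul_self]
  ring

theorem integral_abs_pos : 0 < ∫ s, |s| ∂(gaussianReal 0 1) := by
  rw [integral_pos_iff_support_of_nonneg (fun s => abs_nonneg s) integrable_id_gauss.abs,
    pos_iff_ne_zero]
  intro h0
  have h1 := gaussianReal_absolutelyContinuous' 0 one_ne_zero h0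
  have h2 : Set.Ioo (0 : ℝ) 1 ⊆ Function.support fun s : ℝ => |s| := fun s hs => by
    simpa using hs.1.ne'
  have h3 := measure_mono_null h2 h1
  rw [Real.volume_Ioo] at h3
  simp at h3

/-- The correlation of the label with the first coordinate. -/
noncomputable def firstCorr : ℝ := ∫ z, label (P.link z) * z 0 ∂(gauss 2)

/-- The correlation of the weighted label with the second coordinate. -/
noncomputable def secondCorr : ℝ := ∫ z, label (P.link z) * P.w (z 0) * z 1 ∂(gauss 2)

/-- The correlation of the weighted label with the first coordinate. -/
noncomputable def crossCorr : ℝ := ∫ z, label (P.link z) * P.w (z 0) * z 0 ∂(gauss 2)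

theorem integral_label_mul_one : ∫ z, label (P.link z) * z 1 ∂(gauss 2) = 0 := by
  have h := P.integral_label_mul_eval_one (g := fun _ => 1) measurable_const (by simp)
  have h0 := P.integral_pow_mul_σ 0 (Nat.zero_le _)
  simp only [pow_zero, one_mul] at h0
  simpa [h0] using h

theorem secondCorr_pos : 0 < P.secondCorr := by
  rw [secondCorr, P.integral_label_mul_eval_one P.continuous_w.measurable fun s => by
    rw [abs_of_nonneg (P.w_nonneg s)]; exact P.w_le_one s]
  exact div_pos (mul_pos P.integral_w_mul_σ_pos integral_abs_pos) two_pos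

/-- The first moment of σ vanishes, which is where `1 ≤ m` enters, and leaves half the integral of
|σ(s)|s. As σ lives on s ≥ 1 and w ≤ 1, this dominates half the positive integral of wσ. -/
theorem firstCorr_pos (hm : 1 ≤ m) : 0 < P.firstCorr := by
  have i0 : Integrable (fun _ : ℝ => (1 : ℝ)) (gaussianReal 0 1) := integrable_const _
  have hmeas : Measurable fun s => |P.σ s| := P.measurable_σ.abs
  have i1 : Integrable (fun s => |P.σ s| * s) (gaussianReal 0 1) :=
    integrable_id_gauss.bdd_mul hmeas.aestronglyMeasurable (c := 1)
      (Filter.Eventually.of_forall fun s => by simpa using P.abs_σ_le s)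
  have i2 : Integrable (fun s => P.σ s * s) (gaussianReal 0 1) :=
    integrable_id_gauss.bdd_mul P.measurable_σ.aestronglyMeasurable (c := 1)
      (Filter.Eventually.of_forall fun s => by simpa using P.abs_σ_le s)
  have i3 : Integrable leftSign (gaussianReal 0 1) :=
    Integrable.of_bound measurable_leftSign.aestronglyMeasurable 1
      (Filter.Eventually.of_forall fun s => (abs_leftSign s).le)
  have e : (fun z : Fin 2 → ℝ => label (P.link z) * z 0) = fun z =>
      (|P.σ (z 0)| * z 0 / 2) * 1 + (P.σ (z 0) * z 0) * (leftSign (z 1) / 2) := by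
    ext z
    rw [P.label_link]
    ring
  have h0 := P.integral_pow_mul_σ 1 hm
  simp only [pow_one, mul_comm _ (P.σ _)] at h0
  rw [firstCorr, e, integral_add (integrable_gauss_two (i1.div_const 2) i0)
    (integrable_gauss_two i2 (i3.div_const 2)),
    integral_gauss_two (fun s => |P.σ s| * s / 2) (fun _ => 1),
    integral_gauss_two (fun s => P.σ s * s) (fun s => leftSign s / 2), h0, integral_div]
  have h1 : ∫ s, P.w s * P.σ s ∂(gaussianReal 0 1) ≤ ∫ s, |P.σ s| * s ∂(gaussianReal 0 1) := by
    refine integral_mono P.integrable_w_mul_σ i1 fun s => ?_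
    by_cases h : P.σ s = 0
    · simp [h]
    · have h2 := P.one_le_of_σ_ne_zero s h
      calc P.w s * P.σ s ≤ P.w s * |P.σ s| :=
            mul_le_mul_of_nonneg_left (le_abs_self _) (P.w_nonneg s)
        _ ≤ s * |P.σ s| := mul_le_mul_of_nonneg_right ((P.w_le_one s).trans h2) (abs_nonneg _)
        _ = |P.σ s| * s := mul_comm _ _
  have h2 := P.integral_w_mul_σ_pos
  simp only [zero_mul, add_zero, integral_const, probReal_univ, one_smul, mul_one]
  linarith

end SignProfile

/-! ### Correlations of a multi-index model with the coordinates -/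

theorem integrable_mul_eval_gauss {d : ℕ} {g : (Fin d → ℝ) → ℝ} (hg : Measurable g)
    (hg1 : ∀ x, |g x| ≤ 1) (i : Fin d) : Integrable (fun x => g x * x i) (gauss d) :=
  ((memLp_two_eval_gauss i).integrable (by norm_num)).bdd_mul hg.aestronglyMeasurable (c := 1)
    (Filter.Eventually.of_forall hg1)

theorem measurable_mulVec {d n : ℕ} (U : Matrix (Fin n) (Fin d) ℝ) :
    Measurable fun x : Fin d → ℝ => U *ᵥ x :=
  Continuous.measurable (by fun_prop)

/-- The reflection S = 2UᵀU - 1 preserves the Gaussian and satisfies US = U. Substituting Sx for x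
replaces xᵢ by twice its projection to the row space minus xᵢ, so only the projection contributes to
the integral. -/
theorem integral_comp_frame_mul_eval {d : ℕ} (U : Frame d) {g : (Fin 2 → ℝ) → ℝ}
    (hg : Measurable g) (hg1 : ∀ z, |g z| ≤ 1) (i : Fin d) :
    ∫ x, g (U.1 *ᵥ x) * x i ∂(gauss d) = ∑ k, U.1 k i * ∫ z, g z * z k ∂(gauss 2) := by
  set A := U.1 with hA
  have hU : A * Aᵀ = 1 := U.2
  have hgA : Measurable fun x : Fin d → ℝ => g (A *ᵥ x) := hg.comp (measurable_mulVec A)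
  set S : Matrix (Fin d) (Fin d) ℝ := (2 : ℝ) • (Aᵀ * A) - 1 with hS
  have hAS : A * S = A := by
    rw [hS, Matrix.mul_sub, Matrix.mul_smul, ← Matrix.mul_assoc, hU, Matrix.one_mul,
      Matrix.mul_one, two_smul, add_sub_cancel_right]
  have hST : Sᵀ = S := by simp [hS]
  have hSS : S * Sᵀ = 1 := by
    rw [hST]
    nth_rewrite 1 [hS]
    rw [Matrix.sub_mul, Matrix.smul_mul, Matrix.mul_assoc, hAS, Matrix.one_mul, hS,
      sub_sub_cancel]
  have hint (j) := integrable_mul_eval_gauss hgA (fun x => hg1 _) j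
  have hmeas : Measurable fun x : Fin d → ℝ => g (A *ᵥ x) * x i :=
    hgA.mul (measurable_pi_apply i)
  have h1 := integral_gauss_mulVec S hSS hmeas
  have h2 (x : Fin d → ℝ) : g (A *ᵥ (S *ᵥ x)) * (S *ᵥ x) i =
      2 * (∑ k, A k i * (g (A *ᵥ x) * (A *ᵥ x) k)) - g (A *ᵥ x) * x i := by
    rw [Matrix.mulVec_mulVec, hAS]
    have : (S *ᵥ x) i = 2 * (∑ k, A k i * (A *ᵥ x) k) - x i := by
      rw [hS, Matrix.sub_mulVec, Matrix.smul_mulVec, Matrix.one_mulVec, ← Matrix.mulVec_mulVec]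
      rfl
    rw [this, mul_sub, mul_left_comm, Finset.mul_sum]
    simp_rw [mul_left_comm]
  have hk (k : Fin 2) : Integrable (fun x => g (A *ᵥ x) * (A *ᵥ x) k) (gauss d) :=
    ((memLp_two_dotProduct_gauss (A k)).integrable (by norm_num)).bdd_mul
      hgA.aestronglyMeasurable (c := 1) (Filter.Eventually.of_forall fun x => hg1 _)
  simp_rw [h2] at h1
  rw [integral_sub ((integrable_finsetSum _ fun k _ => (hk k).const_mul _).const_mul 2) (hint i),
    integral_const_mul, integral_finsetSum _ fun k _ => (hk k).const_mul _] at h1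
  simp_rw [integral_const_mul] at h1
  have h3 (k : Fin 2) : ∫ x, g (A *ᵥ x) * (A *ᵥ x) k ∂(gauss d) = ∫ z, g z * z k ∂(gauss 2) :=
    integral_gauss_mulVec A hU (hg.mul (measurable_pi_apply k))
  simp_rw [h3] at h1
  linarith

namespace SignProfile

variable {m : ℕ} (P : SignProfile m)

theorem measurable_model {d : ℕ} (U : Frame d) : Measurable (model P.link U) :=
  P.measurable_link.comp (measurable_mulVec U.1)

theorem measurable_label_model {d : ℕ} (U : Frame d) :
    Measurable fun x => label (model P.link U x) :=
  measurable_label.comp (P.measurable_model U)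

theorem measurable_w_dotProduct {d : ℕ} (a : Fin d → ℝ) : Measurable fun x => P.w (a ⬝ᵥ x) :=
  Continuous.measurable (P.continuous_w.comp (by fun_prop))

theorem integral_label_model_mul_eval {d : ℕ} (U : Frame d) (i : Fin d) :
    ∫ x, label (model P.link U x) * x i ∂(gauss d) = P.firstCorr * U.1 0 i := by
  have h := integral_comp_frame_mul_eval U (g := fun z => label (P.link z))
    (measurable_label.comp P.measurable_link)
    (fun z => by rw [abs_of_nonneg (label_nonneg _)]; exact label_le_one _) i
  rw [Fin.sum_univ_two, P.integral_label_mul_one, mul_zero, add_zero, mul_comm] at h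
  exact h

theorem integral_label_model_mul_w_mul_eval {d : ℕ} (U : Frame d) (i : Fin d) :
    ∫ x, label (model P.link U x) * P.w (U.1 0 ⬝ᵥ x) * x i ∂(gauss d) =
      P.crossCorr * U.1 0 i + P.secondCorr * U.1 1 i := by
  have h := integral_comp_frame_mul_eval U (g := fun z => label (P.link z) * P.w (z 0))
    ((measurable_label.comp P.measurable_link).mul
      (P.continuous_w.measurable.comp (measurable_pi_apply 0)))
    (fun z => by
      rw [abs_of_nonneg (mul_nonneg (label_nonneg _) (P.w_nonneg _))]
      exact mul_le_one₀ (label_le_one _) (P.w_nonneg _) (P.w_le_one _)) i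
  rw [Fin.sum_univ_two, mul_comm, mul_comm (U.1 1 i)] at h
  exact h

/-- Two models with the same first direction are far apart when their second directions are. -/
theorem secondCorr_sq_mul_le_sqError {d : ℕ} (U V : Frame d) (h0 : U.1 0 = V.1 0) :
    P.secondCorr ^ 2 * ∑ i, (U.1 1 i - V.1 1 i) ^ 2 ≤
      sqError (model P.link U) (model P.link V) := by
  set c := P.secondCorr
  set a : Fin d → ℝ := fun i => U.1 1 i - V.1 1 i with ha
  set l : Frame d → (Fin d → ℝ) → ℝ := fun W x => label (model P.link W x) with hl
  have hlm (W) : Measurable (l W) := P.measurable_label_model W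
  have hw := P.measurable_w_dotProduct (U.1 0)
  have hwl (W) (x : Fin d → ℝ) : |l W x * P.w (U.1 0 ⬝ᵥ x)| ≤ 1 := by
    rw [abs_of_nonneg (mul_nonneg (label_nonneg _) (P.w_nonneg _))]
    exact mul_le_one₀ (label_le_one _) (P.w_nonneg _) (P.w_le_one _)
  have hint (W) (i) : Integrable (fun x => l W x * P.w (U.1 0 ⬝ᵥ x) * x i) (gauss d) :=
    integrable_mul_eval_gauss ((hlm W).mul hw) (hwl W) i
  have hdiff (x : Fin d → ℝ) : |l U x - l V x| ≤ 1 := abs_sub_le_of_nonneg_of_le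
    (label_nonneg _) (label_le_one _) (label_nonneg _) (label_le_one _)
  -- Testing the label difference against w(u₀·x)(a·x) with `a` the difference of the second rows:
  -- the `crossCorr` terms cancel because the first rows agree.
  have hD : ∫ x, (l U x - l V x) * (P.w (U.1 0 ⬝ᵥ x) * (a ⬝ᵥ x)) ∂(gauss d) =
      c * ∑ i, a i ^ 2 := by
    have e : (fun x : Fin d → ℝ => (l U x - l V x) * (P.w (U.1 0 ⬝ᵥ x) * (a ⬝ᵥ x))) = fun x =>
        ∑ i, a i * (l U x * P.w (U.1 0 ⬝ᵥ x) * x i - l V x * P.w (U.1 0 ⬝ᵥ x) * x i) := by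
      ext x
      simp only [dotProduct, Finset.mul_sum]
      exact Finset.sum_congr rfl fun i _ => by ring
    have hi (i) : Integrable (fun x => a i *
        (l U x * P.w (U.1 0 ⬝ᵥ x) * x i - l V x * P.w (U.1 0 ⬝ᵥ x) * x i)) (gauss d) :=
      ((hint U i).sub (hint V i)).const_mul _
    rw [e, integral_finsetSum _ fun i _ => hi i, Finset.mul_sum]
    refine Finset.sum_congr rfl fun i _ => ?_
    rw [integral_const_mul, integral_sub (hint U i) (hint V i)]
    have h1 := P.integral_label_model_mul_w_mul_eval U i
    have h2 := P.integral_label_model_mul_w_mul_eval V i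
    rw [← h0] at h2
    simp only [hl]
    rw [h1, h2]
    simp only [ha]
    ring
  have hsq : Integrable (fun x => (l U x - l V x) ^ 2) (gauss d) :=
    Integrable.of_bound (((hlm U).sub (hlm V)).pow_const 2).aestronglyMeasurable 1
      (Filter.Eventually.of_forall fun x => by
        change |(l U x - l V x) ^ 2| ≤ 1
        rw [abs_pow]
        exact pow_le_one₀ (abs_nonneg _) (hdiff x))
  have hasq := (memLp_two_dotProduct_gauss a).integrable_sq
  have hmono : ∫ x, c * ((l U x - l V x) * (P.w (U.1 0 ⬝ᵥ x) * (a ⬝ᵥ x))) ∂(gauss d) ≤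
      ∫ x, ((l U x - l V x) ^ 2 / 2 + c ^ 2 / 2 * (a ⬝ᵥ x) ^ 2) ∂(gauss d) := by
    have hdw (x : Fin d → ℝ) : |(l U x - l V x) * P.w (U.1 0 ⬝ᵥ x)| ≤ 1 := by
      rw [abs_mul, abs_of_nonneg (P.w_nonneg _)]
      exact mul_le_one₀ (hdiff x) (P.w_nonneg _) (P.w_le_one _)
    have hi : Integrable (fun x => (l U x - l V x) * (P.w (U.1 0 ⬝ᵥ x) * (a ⬝ᵥ x))) (gauss d) := by
      simp_rw [← mul_assoc]
      exact ((memLp_two_dotProduct_gauss a).integrable (by norm_num)).bdd_mul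
        (((hlm U).sub (hlm V)).mul hw).aestronglyMeasurable (c := 1)
        (Filter.Eventually.of_forall hdw)
    refine integral_mono (hi.const_mul c) ((hsq.div_const 2).add (hasq.const_mul _)) fun x => ?_
    have h1 : (c * (P.w (U.1 0 ⬝ᵥ x) * (a ⬝ᵥ x))) ^ 2 ≤ c ^ 2 * (a ⬝ᵥ x) ^ 2 := by
      rw [mul_pow, mul_pow]
      refine mul_le_mul_of_nonneg_left (mul_le_of_le_one_left (sq_nonneg _) ?_) (sq_nonneg _)
      exact pow_le_one₀ (P.w_nonneg _) (P.w_le_one _)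
    -- With D the label difference and t the test function, cDt ≤ D²/2 + c²t²/2; after integration
    -- half of c²|a|² is absorbed on the left.
    have h2 := sq_nonneg ((l U x - l V x) - c * (P.w (U.1 0 ⬝ᵥ x) * (a ⬝ᵥ x)))
    change _ ≤ (l U x - l V x) ^ 2 / 2 + c ^ 2 / 2 * (a ⬝ᵥ x) ^ 2
    nlinarith
  rw [integral_const_mul, hD, integral_add (hsq.div_const 2) (hasq.const_mul _), integral_div,
    integral_const_mul, integral_dotProduct_sq_gauss] at hmono
  have : sqError (model P.link U) (model P.link V) = ∫ x, (l U x - l V x) ^ 2 ∂(gauss d) := rfl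
  rw [this]
  nlinarith

end SignProfile

/-! ### Truncated correlation queries -/

/-- The statistical query for the correlation of the weighted label with a coordinate, truncated
at height `T`. -/
noncomputable def corrQuery {d : ℕ} (T : ℝ) (g : (Fin d → ℝ) → ℝ) (hg : Measurable g)
    (hg1 : ∀ x, |g x| ≤ 1) (i : Fin d) : Query ((Fin d → ℝ) × Bool) where
  toFun p := label p.2 * g p.1 * if |p.1 i| ≤ T then p.1 i / T else 0
  measurable := by
    have hi : Measurable fun p : (Fin d → ℝ) × Bool => p.1 i :=
      (measurable_pi_apply i).comp measurable_fst
    exact ((measurable_label.comp measurable_snd).mul (hg.comp measurable_fst)).mul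
      (Measurable.ite (measurableSet_le hi.abs measurable_const) (hi.div_const T)
        measurable_const)
  bounded p := by
    rw [Set.mem_Icc, ← abs_le, abs_mul, abs_mul, abs_of_nonneg (label_nonneg _)]
    refine mul_le_one₀ (mul_le_one₀ (label_le_one _) (abs_nonneg _) (hg1 _)) (abs_nonneg _) ?_
    split_ifs with h
    · rw [abs_div]
      exact div_le_one_of_le₀ (h.trans (le_abs_self T)) (abs_nonneg _)
    · simp

/-- The query has variance at most 1/T², so with parameter T² both alternatives in the oracle
tolerance are at most 1/T², giving 1/T after rescaling. Truncation costs another 1/T, since |xᵢ| ≤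
xᵢ²/T where |xᵢ| > T. -/
theorem abs_mul_answer_sub_integral_le {d : ℕ} {T : ℝ} (hT : 0 < T) {g : (Fin d → ℝ) → ℝ}
    (hg : Measurable g) (hg1 : ∀ x, |g x| ≤ 1) (i : Fin d) {h : (Fin d → ℝ) → Bool}
    (hh : Measurable h) {v : ℝ}
    (hv : IsVSTATAnswer (labelledLaw h) (T ^ 2) (corrQuery T g hg hg1 i) v) :
    |T * v - ∫ x, label (h x) * g x * x i ∂(gauss d)| ≤ 2 / T := by
  set q := corrQuery T g hg hg1 i with hq
  have hpair : Measurable fun x : Fin d → ℝ => (x, h x) := measurable_id.prodMk hh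
  have : IsProbabilityMeasure (labelledLaw h) :=
    Measure.isProbabilityMeasure_map hpair.aemeasurable
  have hmap {f : (Fin d → ℝ) × Bool → ℝ} (hf : Measurable f) :
      ∫ p, f p ∂(labelledLaw h) = ∫ x, f (x, h x) ∂(gauss d) :=
    integral_map hpair.aemeasurable hf.aestronglyMeasurable
  have hlg (x) : |label (h x) * g x| ≤ 1 := by
    rw [abs_mul, abs_of_nonneg (label_nonneg _)]
    exact mul_le_one₀ (label_le_one _) (abs_nonneg _) (hg1 _)
  have hlgm : Measurable fun x => label (h x) * g x := (measurable_label.comp hh).mul hg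
  have hsqi : Integrable (fun x : Fin d → ℝ => x i ^ 2) (gauss d) :=
    (memLp_two_eval_gauss i).integrable_sq
  have hqm : Measurable fun x => q.toFun (x, h x) := q.measurable.comp hpair
  have hqb (x) : |q.toFun (x, h x)| ≤ 1 := abs_le.2 (q.bounded _)
  have hvar : variance q.toFun (labelledLaw h) ≤ 1 / T ^ 2 := by
    refine (variance_le_expectation_sq q.measurable.aestronglyMeasurable).trans ?_
    have e : ∫ p, (q.toFun ^ 2) p ∂(labelledLaw h) = ∫ x, q.toFun (x, h x) ^ 2 ∂(gauss d) :=
      hmap (q.measurable.pow_const 2)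
    rw [e]
    calc ∫ x, q.toFun (x, h x) ^ 2 ∂(gauss d) ≤ ∫ x, x i ^ 2 / T ^ 2 ∂(gauss d) := by
          refine integral_mono_of_nonneg (Filter.Eventually.of_forall fun x => sq_nonneg _)
            (hsqi.div_const _) (Filter.Eventually.of_forall fun x => ?_)
          change (label (h x) * g x * if |x i| ≤ T then x i / T else 0) ^ 2 ≤ x i ^ 2 / T ^ 2
          rw [mul_pow, ← div_pow]
          refine (mul_le_of_le_one_left (sq_nonneg _) ?_).trans ?_
          · rw [← sq_abs]; exact pow_le_one₀ (abs_nonneg _) (hlg x)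
          · split_ifs
            · exact le_rfl
            · rw [zero_pow two_ne_zero]; exact sq_nonneg _
      _ = 1 / T ^ 2 := by rw [integral_div, integral_eval_sq_gauss]
  have hmean : |v - ∫ x, q.toFun (x, h x) ∂(gauss d)| ≤ 1 / T ^ 2 := by
    rw [← hmap q.measurable]
    refine hv.trans (max_le le_rfl ?_)
    refine Real.sqrt_le_iff.2 ⟨by positivity, ?_⟩
    rw [sq (1 / T ^ 2), div_eq_mul_one_div (variance _ _)]
    exact mul_le_mul_of_nonneg_right hvar (by positivity)
  have htrunc : |T * ∫ x, q.toFun (x, h x) ∂(gauss d) -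
      ∫ x, label (h x) * g x * x i ∂(gauss d)| ≤ 1 / T := by
    have i1 : Integrable (fun x => T * q.toFun (x, h x)) (gauss d) :=
      (Integrable.of_bound hqm.aestronglyMeasurable 1
        (Filter.Eventually.of_forall hqb)).const_mul T
    have i2 : Integrable (fun x => label (h x) * g x * x i) (gauss d) :=
      integrable_mul_eval_gauss hlgm hlg i
    rw [← integral_const_mul, ← integral_sub i1 i2]
    refine abs_integral_le_integral_abs.trans ?_
    calc ∫ x, |T * q.toFun (x, h x) - label (h x) * g x * x i| ∂(gauss d) ≤
          ∫ x, x i ^ 2 / T ∂(gauss d) := by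
          refine integral_mono_of_nonneg (Filter.Eventually.of_forall fun x => abs_nonneg _)
            (hsqi.div_const _) (Filter.Eventually.of_forall fun x => ?_)
          change |T * (label (h x) * g x * if |x i| ≤ T then x i / T else 0) -
            label (h x) * g x * x i| ≤ x i ^ 2 / T
          split_ifs with hx
          · rw [show T * (label (h x) * g x * (x i / T)) - label (h x) * g x * x i = 0 by
              field_simp; ring, abs_zero]
            positivity
          · rw [mul_zero, mul_zero, zero_sub, abs_neg, abs_mul, le_div_iff₀ hT, ← sq_abs, sq]
            have h1 : |label (h x) * g x| * |x i| ≤ |x i| :=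
              mul_le_of_le_one_left (abs_nonneg _) (hlg x)
            exact mul_le_mul h1 (not_le.1 hx).le hT.le (abs_nonneg _)
      _ = 1 / T := by rw [integral_div, integral_eval_sq_gauss]
  set E := ∫ x, q.toFun (x, h x) ∂(gauss d)
  set I := ∫ x, label (h x) * g x * x i ∂(gauss d)
  calc |T * v - I| = |T * (v - E) + (T * E - I)| := by congr 1; ring
    _ ≤ |T * (v - E)| + |T * E - I| := abs_add_le _ _
    _ ≤ T * (1 / T ^ 2) + 1 / T := by
        rw [abs_mul, abs_of_pos hT]
        exact add_le_add (mul_le_mul_of_nonneg_left hmean hT.le) htrunc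
    _ = 2 / T := by field_simp; ring

/-- The spectral norm is at most the Frobenius norm. -/
theorem norm_le_of_sum_sq_le {m n : ℕ} (M : Matrix (Fin m) (Fin n) ℝ) {ε : ℝ} (hε : 0 ≤ ε)
    (h : ∑ i, ∑ j, M i j ^ 2 ≤ ε ^ 2) : ‖M‖ ≤ ε := by
  rw [Matrix.l2_opNorm_def]
  refine ContinuousLinearMap.opNorm_le_bound _ hε fun x => ?_
  rw [← abs_of_nonneg (norm_nonneg _), ← abs_of_nonneg (mul_nonneg hε (norm_nonneg x)),
    ← sq_le_sq, mul_pow, EuclideanSpace.real_norm_sq_eq, EuclideanSpace.real_norm_sq_eq]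
  refine le_trans ?_ (mul_le_mul_of_nonneg_right h (Finset.sum_nonneg fun j _ => sq_nonneg (x j)))
  rw [Finset.sum_mul]
  exact Finset.sum_le_sum fun i _ => Finset.sum_mul_sq_le_sq_mul_sq Finset.univ (M i) x

namespace SignProfile

variable {m : ℕ} (P : SignProfile m)

theorem abs_w_le (s : ℝ) : |P.w s| ≤ 1 := by
  rw [abs_of_nonneg (P.w_nonneg s)]; exact P.w_le_one s

/-! ### The statistical query algorithm -/

/-- The adaptive algorithm: the first `d` queries estimate the first direction, the other `d`
queries use this estimate as the argument of the weight. -/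
noncomputable def sqAlgorithm (d : ℕ) (T : ℝ) :
    SQAlgorithm ((Fin d → ℝ) × Bool) (Matrix (Fin 2) (Fin d) ℝ) (2 * d) where
  ask i prev :=
    if h : (i : ℕ) < d then
      corrQuery T (fun _ => 1) measurable_const (by simp) ⟨i, h⟩
    else
      corrQuery T (fun x => P.w ((fun j : Fin d => T * prev ⟨j, by omega⟩ / P.firstCorr) ⬝ᵥ x))
        (P.measurable_w_dotProduct _) (fun _ => P.abs_w_le _) ⟨i - d, by omega⟩
  -- The second row solves weighted correlation = `crossCorr` · row 0 + `secondCorr` · row 1, using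
  -- the estimate of row 0.
  output a := Matrix.of ![fun j => T * a ⟨j, by omega⟩ / P.firstCorr,
    fun j => (T * a ⟨d + j, by omega⟩ -
      P.crossCorr * (T * a ⟨j, by omega⟩ / P.firstCorr)) / P.secondCorr]

/-- `w` is 1-Lipschitz, and |(a-b)·x||xᵢ| ≤ ((a-b)·x)²/(2δ) + δxᵢ²/2 has mean at most δ. The bound
involves only the Euclidean error of the direction. -/
theorem abs_integral_w_sub_le {d : ℕ} {h : (Fin d → ℝ) → Bool} (hh : Measurable h)
    (a b : Fin d → ℝ) {δ : ℝ} (hδ : 0 < δ) (hab : ∑ j, (a j - b j) ^ 2 ≤ δ ^ 2) (i : Fin d) :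
    |∫ x, label (h x) * P.w (a ⬝ᵥ x) * x i ∂(gauss d) -
      ∫ x, label (h x) * P.w (b ⬝ᵥ x) * x i ∂(gauss d)| ≤ δ := by
  have hlm : Measurable fun x => label (h x) := measurable_label.comp hh
  have hint (c : Fin d → ℝ) : Integrable (fun x => label (h x) * P.w (c ⬝ᵥ x) * x i) (gauss d) :=
    integrable_mul_eval_gauss (hlm.mul (P.measurable_w_dotProduct c)) (fun x => by
      change |label (h x) * P.w (c ⬝ᵥ x)| ≤ 1
      rw [abs_of_nonneg (mul_nonneg (label_nonneg _) (P.w_nonneg _))]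
      exact mul_le_one₀ (label_le_one _) (P.w_nonneg _) (P.w_le_one _)) i
  rw [← integral_sub (hint a) (hint b)]
  refine abs_integral_le_integral_abs.trans ?_
  have hsq : Integrable (fun x => ((a - b) ⬝ᵥ x) ^ 2) (gauss d) :=
    (memLp_two_dotProduct_gauss (a - b)).integrable_sq
  have hsqi : Integrable (fun x : Fin d → ℝ => x i ^ 2) (gauss d) :=
    (memLp_two_eval_gauss i).integrable_sq
  calc ∫ x, |label (h x) * P.w (a ⬝ᵥ x) * x i - label (h x) * P.w (b ⬝ᵥ x) * x i| ∂(gauss d) ≤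
        ∫ x, (((a - b) ⬝ᵥ x) ^ 2 / (2 * δ) + δ / 2 * x i ^ 2) ∂(gauss d) := by
        refine integral_mono_of_nonneg (Filter.Eventually.of_forall fun x => abs_nonneg _)
          ((hsq.div_const _).add (hsqi.const_mul _)) (Filter.Eventually.of_forall fun x => ?_)
        have h1 : |label (h x) * P.w (a ⬝ᵥ x) * x i - label (h x) * P.w (b ⬝ᵥ x) * x i| ≤
            |(a - b) ⬝ᵥ x| * |x i| := by
          rw [← sub_mul, ← mul_sub, abs_mul, abs_mul, abs_of_nonneg (label_nonneg _),
            sub_dotProduct]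
          refine mul_le_mul_of_nonneg_right ?_ (abs_nonneg _)
          exact (mul_le_of_le_one_left (abs_nonneg _) (label_le_one _)).trans
            (P.w_lipschitz _ _)
        refine h1.trans ?_
        change _ ≤ ((a - b) ⬝ᵥ x) ^ 2 / (2 * δ) + δ / 2 * x i ^ 2
        rw [← sq_abs ((a - b) ⬝ᵥ x), ← sq_abs (x i)]
        have h2 : |(a - b) ⬝ᵥ x| ^ 2 / (2 * δ) + δ / 2 * |x i| ^ 2 - |(a - b) ⬝ᵥ x| * |x i| =
            (|(a - b) ⬝ᵥ x| - δ * |x i|) ^ 2 / (2 * δ) := by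
          field_simp; ring
        have h3 : 0 ≤ (|(a - b) ⬝ᵥ x| - δ * |x i|) ^ 2 / (2 * δ) := by positivity
        linarith
    _ = (∑ j, (a j - b j) ^ 2) / (2 * δ) + δ / 2 := by
        rw [integral_add (hsq.div_const _) (hsqi.const_mul _), integral_div, integral_const_mul,
          integral_dotProduct_sq_gauss, integral_eval_sq_gauss, mul_one]
        simp
    _ ≤ δ ^ 2 / (2 * δ) + δ / 2 := by gcongr
    _ = δ := by field_simp; ring

/-- The factor by which the algorithm amplifies the errors of the answers. -/
noncomputable def amplification : ℝ :=
  2 / P.firstCorr + (2 + 2 / P.firstCorr + |P.crossCorr| * (2 / P.firstCorr)) / P.secondCorr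

theorem amplification_pos (hm : 1 ≤ m) : 0 < P.amplification := by
  have h1 := P.firstCorr_pos hm
  have h2 := P.secondCorr_pos
  unfold amplification
  positivity

/-- Row 0 has entrywise error of order 1/T, hence Euclidean error of order √d/T. This whole error
can enter each entry of row 1 through the weight, whence the factor √d. -/
theorem abs_output_sub_le (hm : 1 ≤ m) {d : ℕ} (hd : 1 ≤ d) {T : ℝ} (hT : 0 < T) (U : Frame d)
    {a : Fin (2 * d) → ℝ}
    (ha : (P.sqAlgorithm d T).IsTranscript (labelledLaw (model P.link U)) (T ^ 2) a)
    (k : Fin 2) (j : Fin d) :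
    |((P.sqAlgorithm d T).output a - U.1) k j| ≤ P.amplification * (Real.sqrt d / T) := by
  have hc1 := P.firstCorr_pos hm
  have hc2 := P.secondCorr_pos
  set u : Fin d → ℝ := fun j => T * a ⟨j, by omega⟩ / P.firstCorr with hu
  have hsqrt : 1 ≤ Real.sqrt d := by
    rw [Real.one_le_sqrt]; exact_mod_cast hd
  have hrow (j : Fin d) : |u j - U.1 0 j| ≤ 2 / P.firstCorr / T := by
    have h := ha ⟨j, by omega⟩
    simp only [sqAlgorithm, Fin.is_lt, dif_pos] at h
    have h' := abs_mul_answer_sub_integral_le hT _ _ _ (P.measurable_model U) h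
    simp only [mul_one, Fin.eta] at h'
    rw [P.integral_label_model_mul_eval] at h'
    have e : u j - U.1 0 j = (T * a ⟨j, by omega⟩ - P.firstCorr * U.1 0 j) / P.firstCorr := by
      simp only [hu]; field_simp
    rw [e, abs_div, abs_of_pos hc1, div_right_comm]
    exact div_le_div_of_nonneg_right h' hc1.le
  have hT' : 1 / T ≤ Real.sqrt d / T := div_le_div_of_nonneg_right hsqrt hT.le
  have hrow' (j : Fin d) : |u j - U.1 0 j| ≤ 2 / P.firstCorr * (Real.sqrt d / T) := by
    refine (hrow j).trans ?_
    rw [div_eq_mul_one_div _ T]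
    exact mul_le_mul_of_nonneg_left hT' (by positivity)
  have hsplit : P.amplification * (Real.sqrt d / T) = 2 / P.firstCorr * (Real.sqrt d / T) +
      (2 + 2 / P.firstCorr + |P.crossCorr| * (2 / P.firstCorr)) * (Real.sqrt d / T) /
        P.secondCorr := by
    unfold amplification; ring
  rw [hsplit]
  have hk : k = 0 ∨ k = 1 := by omega
  rcases hk with rfl | rfl
  · have : ((P.sqAlgorithm d T).output a - U.1) 0 j = u j - U.1 0 j := rfl
    rw [this]
    refine (hrow' j).trans (le_add_of_nonneg_right ?_)
    positivity
  · have h := ha ⟨d + j, by omega⟩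
    simp only [sqAlgorithm, not_lt.2 (Nat.le_add_right d j), dif_neg, not_false_eq_true] at h
    have h' := abs_mul_answer_sub_integral_le hT _ _ _ (P.measurable_model U) h
    simp only [Nat.add_sub_cancel_left, Fin.eta] at h'
    change |T * a ⟨d + j, _⟩ - ∫ x, label (model P.link U x) * P.w (u ⬝ᵥ x) * x j ∂(gauss d)| ≤
      2 / T at h'
    have hδ : 0 < 2 / P.firstCorr * (Real.sqrt d / T) := by positivity
    have hsum : ∑ j, (u j - U.1 0 j) ^ 2 ≤ (2 / P.firstCorr * (Real.sqrt d / T)) ^ 2 := by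
      calc ∑ j, (u j - U.1 0 j) ^ 2 ≤ ∑ _j : Fin d, (2 / P.firstCorr / T) ^ 2 :=
            Finset.sum_le_sum fun j _ => by
              rw [← sq_abs]; exact pow_le_pow_left₀ (abs_nonneg _) (hrow j) 2
        _ = (2 / P.firstCorr * (Real.sqrt d / T)) ^ 2 := by
            rw [Finset.sum_const, Finset.card_univ, Fintype.card_fin, nsmul_eq_mul, mul_pow,
              div_pow (Real.sqrt d), Real.sq_sqrt (Nat.cast_nonneg d)]
            ring
    have hw := P.abs_integral_w_sub_le (P.measurable_model U) u (U.1 0) hδ hsum j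
    rw [P.integral_label_model_mul_w_mul_eval] at hw
    set I := ∫ x, label (model P.link U x) * P.w (u ⬝ᵥ x) * x j ∂(gauss d)
    -- Three sources of error: the oracle and truncation, the weight taken along `u` instead of the
    -- true row, and the subtracted multiple of row 0.
    have e : ((P.sqAlgorithm d T).output a - U.1) 1 j =
        ((T * a ⟨d + j, by omega⟩ - I) +
          (I - (P.crossCorr * U.1 0 j + P.secondCorr * U.1 1 j)) -
          P.crossCorr * (u j - U.1 0 j)) / P.secondCorr := by
      have : ((P.sqAlgorithm d T).output a - U.1) 1 j =
        (T * a ⟨d + j, by omega⟩ - P.crossCorr * u j) / P.secondCorr - U.1 1 j := rfl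
      rw [this]
      field_simp
      ring
    rw [e, abs_div, abs_of_pos hc2]
    refine le_trans (div_le_div_of_nonneg_right ?_ hc2.le)
      (le_add_of_nonneg_left hδ.le)
    refine (abs_sub _ _).trans ?_
    refine (add_le_add (abs_add_le _ _) le_rfl).trans ?_
    rw [abs_mul, add_mul, add_mul, mul_assoc]
    refine add_le_add (add_le_add (h'.trans ?_) hw)
      (mul_le_mul_of_nonneg_left (hrow' j) (abs_nonneg _))
    rw [div_eq_mul_one_div]
    exact mul_le_mul_of_nonneg_left hT' two_pos.le

theorem norm_output_sub_le (hm : 1 ≤ m) {d : ℕ} (hd : 1 ≤ d) {C ε : ℝ}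
    (hC : 2 * P.amplification ^ 2 ≤ C) (hε : 0 < ε) (U : Frame d) {a : Fin (2 * d) → ℝ}
    (ha : (P.sqAlgorithm d (Real.sqrt C * d / ε)).IsTranscript (labelledLaw (model P.link U))
      (C * d ^ 2 / ε ^ 2) a) :
    ‖(P.sqAlgorithm d (Real.sqrt C * d / ε)).output a - U.1‖ ≤ ε := by
  have hA := P.amplification_pos hm
  have hCpos : 0 < C := lt_of_lt_of_le (by positivity) hC
  have hd0 : (0 : ℝ) < d := by exact_mod_cast hd
  -- T² is the oracle parameter. The 2d entries, each with squared error A²d/T², total 2A²ε²/C.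
  set T := Real.sqrt C * d / ε with hTdef
  have hT : 0 < T := by positivity
  have hT2 : C * d ^ 2 / ε ^ 2 = T ^ 2 := by
    rw [hTdef, div_pow, mul_pow, Real.sq_sqrt hCpos.le]
  rw [hT2] at ha
  refine norm_le_of_sum_sq_le _ hε.le ?_
  calc ∑ k, ∑ j, ((P.sqAlgorithm d T).output a - U.1) k j ^ 2 ≤
        ∑ _k : Fin 2, ∑ _j : Fin d, (P.amplification * (Real.sqrt d / T)) ^ 2 :=
        Finset.sum_le_sum fun k _ => Finset.sum_le_sum fun j _ => by
          rw [← sq_abs]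
          exact pow_le_pow_left₀ (abs_nonneg _) (P.abs_output_sub_le hm hd hT U ha k j) 2
    _ = 2 * P.amplification ^ 2 / C * ε ^ 2 := by
        rw [Finset.sum_const, Finset.sum_const, mul_pow, div_pow, ← hT2,
          Real.sq_sqrt hd0.le]
        simp only [Finset.card_univ, Fintype.card_fin, nsmul_eq_mul, Nat.cast_ofNat]
        field_simp
    _ ≤ ε ^ 2 := mul_le_of_le_one_left (sq_nonneg _) ((div_le_one hCpos).2 hC)

end SignProfile

/-! ### Frames with the same low-degree moments -/

/-- The vector `±1 / √n` whose positive coordinates are those in `S`. -/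
noncomputable def signVector {n : ℕ} (S : Finset (Fin n)) (j : Fin n) : ℝ :=
  (if j ∈ S then 1 else -1) / Real.sqrt n

theorem sum_signVector_sq {n : ℕ} (hn : 1 ≤ n) (S : Finset (Fin n)) :
    ∑ j, signVector S j ^ 2 = 1 := by
  have hn0 : (0 : ℝ) < n := by exact_mod_cast hn
  have h (j) : signVector S j ^ 2 = 1 / n := by
    unfold signVector
    rw [div_pow, Real.sq_sqrt hn0.le]
    split_ifs <;> norm_num
  simp_rw [h]
  rw [Finset.sum_const, Finset.card_univ, Fintype.card_fin, nsmul_eq_mul, mul_one_div,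
    div_self hn0.ne']

theorem sum_signVector_sub_sq {n : ℕ} (hn : 1 ≤ n) (S S' : Finset (Fin n)) :
    ∑ j, (signVector S j - signVector S' j) ^ 2 = 4 * (symmDiff S S').card / n := by
  have hn0 : (0 : ℝ) < n := by exact_mod_cast hn
  have h (j) : (signVector S j - signVector S' j) ^ 2 =
      if j ∈ symmDiff S S' then (4 : ℝ) / n else 0 := by
    unfold signVector
    rw [← sub_div, div_pow, Real.sq_sqrt hn0.le]
    by_cases h1 : j ∈ S <;> by_cases h2 : j ∈ S' <;> simp [Finset.mem_symmDiff, h1, h2] <;>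
      norm_num
  simp_rw [h]
  rw [Finset.sum_ite_mem, Finset.univ_inter, Finset.sum_const, nsmul_eq_mul]
  ring

/-- The frame with rows `e₀` and `(0, signVector S)`. -/
noncomputable def signFrame {n : ℕ} (hn : 1 ≤ n) (S : Finset (Fin n)) : Frame (n + 1) :=
  ⟨Matrix.of ![Fin.cons 1 0, Fin.cons 0 (signVector S)], by
    have h := sum_signVector_sq hn S
    ext i j
    fin_cases i <;> fin_cases j <;>
      simp [Matrix.mul_apply, Fin.sum_univ_succ, ← sq, h]⟩

theorem signFrame_mulVec_cons {n : ℕ} (hn : 1 ≤ n) (S : Finset (Fin n)) (s : ℝ) (y : Fin n → ℝ) :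
    (signFrame hn S).1 *ᵥ (Fin.cons s y : Fin (n + 1) → ℝ) = ![s, signVector S ⬝ᵥ y] := by
  ext i
  fin_cases i <;> simp [signFrame, Matrix.mulVec, dotProduct, Fin.sum_univ_succ]

theorem integral_gauss_succ {n : ℕ} (g : (Fin (n + 1) → ℝ) → ℝ) :
    ∫ x, g x ∂(gauss (n + 1)) =
      ∫ p, g (Fin.cons p.1 p.2) ∂((gaussianReal 0 1).prod (gauss n)) := by
  have h := (measurePreserving_piFinSuccAbove (fun _ : Fin (n + 1) => gaussianReal 0 1) 0).symm
  rw [gauss, ← h.integral_comp']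
  simp only [MeasurableEquiv.piFinSuccAbove_symm_apply, Fin.insertNthEquiv_zero, gauss]
  rfl

theorem integrable_pow_gaussianReal (a : ℕ) : Integrable (fun s : ℝ => s ^ a) (gaussianReal 0 1) :=
  (integrable_norm_iff (by fun_prop)).1 (by
    simpa using MemLp.integrable_norm_pow' (memLp_id_gaussianReal (μ := 0) (v := 1) a))

theorem integrable_monomial_gauss {d : ℕ} (α : Fin d → ℕ) :
    Integrable (fun x : Fin d → ℝ => ∏ i, x i ^ α i) (gauss d) :=
  Integrable.fintype_prod fun i => integrable_pow_gaussianReal (α i)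

namespace SignProfile

variable {m : ℕ} (P : SignProfile m)

/-- Both sides equal the moments of |σ(x₀)|/2. The remaining part of the label splits off the factor
σ(x₀), because the second row of the frame does not involve x₀; the exponent of x₀ is at most `m`,
so its integral is zero. -/
theorem moments_signFrame {n k : ℕ} (hk : k ≤ m) (hn : 1 ≤ n) (S S' : Finset (Fin n)) :
    moments k (model P.link (signFrame hn S)) = moments k (model P.link (signFrame hn S')) := by
  suffices h : ∀ S : Finset (Fin n), ∀ α : Fin (n + 1) → ℕ, ∑ i, α i ≤ k →
      ∫ x, (∏ i, x i ^ α i) * label (model P.link (signFrame hn S) x) ∂(gauss (n + 1)) =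
        ∫ x, (∏ i, x i ^ α i) * (|P.σ (x 0)| / 2) ∂(gauss (n + 1)) by
    funext α
    exact (h S α.1 α.2).trans (h S' α.1 α.2).symm
  intro S α hα
  have hm (x : Fin (n + 1) → ℝ) : (∏ i, x i ^ α i) * label (model P.link (signFrame hn S) x) -
      (∏ i, x i ^ α i) * (|P.σ (x 0)| / 2) =
      (∏ i, x i ^ α i) * (P.σ (x 0) * leftSign (((signFrame hn S).1 *ᵥ x) 1) / 2) := by
    have h0 : ((signFrame hn S).1 *ᵥ x) 0 = x 0 := by
      simp [signFrame, Matrix.mulVec, dotProduct, Fin.sum_univ_succ]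
    rw [model, P.label_link, h0]
    ring
  have hσ : Measurable fun x : Fin (n + 1) → ℝ => |P.σ (x 0)| / 2 :=
    (P.measurable_σ.comp (measurable_pi_apply 0)).abs.div_const 2
  have i1 : Integrable (fun x => (∏ i, x i ^ α i) * label (model P.link (signFrame hn S) x))
      (gauss (n + 1)) :=
    (integrable_monomial_gauss α).mul_bdd (c := 1)
      (P.measurable_label_model _).aestronglyMeasurable
      (Filter.Eventually.of_forall fun x => by
        rw [Real.norm_eq_abs, abs_of_nonneg (label_nonneg _)]; exact label_le_one _)
  have i2 : Integrable (fun x => (∏ i, x i ^ α i) * (|P.σ (x 0)| / 2)) (gauss (n + 1)) :=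
    (integrable_monomial_gauss α).mul_bdd (c := 1) hσ.aestronglyMeasurable
      (Filter.Eventually.of_forall fun x => by
        rw [Real.norm_eq_abs, abs_of_nonneg (by positivity)]
        linarith [P.abs_σ_le (x 0)])
  rw [← sub_eq_zero, ← integral_sub i1 i2]
  simp_rw [hm]
  rw [integral_gauss_succ]
  simp_rw [signFrame_mulVec_cons]
  have e : (fun p : ℝ × (Fin n → ℝ) =>
      (∏ i, (Fin.cons p.1 p.2 : Fin (n + 1) → ℝ) i ^ α i) *
        (P.σ ((Fin.cons p.1 p.2 : Fin (n + 1) → ℝ) 0) *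
          leftSign (![p.1, signVector S ⬝ᵥ p.2] 1) / 2)) = fun p =>
      (p.1 ^ α 0 * P.σ p.1) *
        ((∏ i : Fin n, p.2 i ^ α i.succ) * leftSign (signVector S ⬝ᵥ p.2) / 2) := by
    ext p
    rw [Fin.prod_univ_succ]
    simp only [Fin.cons_zero, Fin.cons_succ, Matrix.cons_val_one,
      Matrix.cons_val_fin_one]
    ring
  rw [e, integral_prod_mul (fun s => s ^ α 0 * P.σ s) (fun y : Fin n → ℝ =>
    (∏ i : Fin n, y i ^ α i.succ) * leftSign (signVector S ⬝ᵥ y) / 2),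
    P.integral_pow_mul_σ, zero_mul]
  exact (Finset.single_le_sum (f := α) (fun _ _ => Nat.zero_le _) (Finset.mem_univ 0)).trans
    (hα.trans hk)

theorem measurableSet_sqError_le {d : ℕ} (U : Frame d) (r : ℝ) :
    MeasurableSet {V : Frame d | sqError (model P.link U) (model P.link V) ≤ r} := by
  have hentry (i : Fin 2) (j : Fin d) : Measurable fun V : Frame d => V.1 i j :=
    (measurable_pi_apply j).comp ((measurable_pi_apply i).comp
      (comap_measurable fun (U : Frame d) (i : Fin 2) (j : Fin d) => U.1 i j))
  have hmul : Measurable fun p : Frame d × (Fin d → ℝ) => p.1.1 *ᵥ p.2 := by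
    refine measurable_pi_lambda _ fun i => ?_
    simp only [Matrix.mulVec, dotProduct]
    exact Finset.measurable_sum _ fun j _ => ((hentry i j).comp measurable_fst).mul
      ((measurable_pi_apply j).comp measurable_snd)
  have hfun : Measurable fun p : Frame d × (Fin d → ℝ) =>
      (label (model P.link U p.2) - label (model P.link p.1 p.2)) ^ 2 :=
    (((P.measurable_label_model U).comp measurable_snd).sub
      (measurable_label.comp (P.measurable_link.comp hmul))).pow_const 2
  exact measurableSet_le hfun.stronglyMeasurable.integral_prod_right'.measurable
    measurable_const

theorem integrable_sq_label_sub {d : ℕ} (U V : Frame d) :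
    Integrable (fun x => (label (model P.link U x) - label (model P.link V x)) ^ 2) (gauss d) :=
  Integrable.of_bound
    (((P.measurable_label_model U).sub (P.measurable_label_model V)).pow_const 2).aestronglyMeasurable
    1 (Filter.Eventually.of_forall fun x => by
      change |(label (model P.link U x) - label (model P.link V x)) ^ 2| ≤ 1
      rw [abs_pow]
      exact pow_le_one₀ (abs_nonneg _) (abs_sub_le_of_nonneg_of_le
        (label_nonneg _) (label_le_one _) (label_nonneg _) (label_le_one _)))

/-- On 0/1 values the squared difference is the discrete metric, so no factor 2 is lost. -/
theorem sqError_triangle {d : ℕ} (U V W : Frame d) :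
    sqError (model P.link U) (model P.link W) ≤
      sqError (model P.link U) (model P.link V) + sqError (model P.link W) (model P.link V) := by
  unfold sqError
  rw [← integral_add (P.integrable_sq_label_sub U V) (P.integrable_sq_label_sub W V)]
  refine integral_mono (P.integrable_sq_label_sub U W)
    ((P.integrable_sq_label_sub U V).add (P.integrable_sq_label_sub W V)) fun x => ?_
  change _ ≤ (label (model P.link U x) - label (model P.link V x)) ^ 2 +
    (label (model P.link W x) - label (model P.link V x)) ^ 2
  cases model P.link U x <;> cases model P.link V x <;> cases model P.link W x <;> simp [label]

theorem four_mul_card_symmDiff_le {n : ℕ} (hn : 1 ≤ n) {C : ℝ} (hC0 : 0 < C)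
    (hC : 2 ≤ P.secondCorr ^ 2 * C) (S S' : Finset (Fin n)) (V : Frame (n + 1))
    (hS : sqError (model P.link (signFrame hn S)) (model P.link V) ≤ 1 / C)
    (hS' : sqError (model P.link (signFrame hn S')) (model P.link V) ≤ 1 / C) :
    4 * (symmDiff S S').card ≤ n := by
  have h1 := P.secondCorr_sq_mul_le_sqError (signFrame hn S) (signFrame hn S') rfl
  have h2 := P.sqError_triangle (signFrame hn S) V (signFrame hn S')
  have h3 : ∑ i, ((signFrame hn S).1 1 i - (signFrame hn S').1 1 i) ^ 2 =
      4 * (symmDiff S S').card / n := by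
    rw [← sum_signVector_sub_sq hn, Fin.sum_univ_succ]
    simp [signFrame]
  rw [h3] at h1
  have hn0 : (0 : ℝ) < n := by exact_mod_cast hn
  have hc := pow_pos P.secondCorr_pos 2
  have h4 : P.secondCorr ^ 2 * (4 * (symmDiff S S').card / n) ≤ 2 / C := by
    have : (2 : ℝ) / C = 1 / C + 1 / C := by ring
    linarith
  have h5 : 2 / C ≤ P.secondCorr ^ 2 * 1 := by
    rw [mul_one, div_le_iff₀ hC0]; exact hC
  have h6 := le_of_mul_le_mul_left (h4.trans h5) hc
  rw [div_le_one hn0] at h6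
  exact_mod_cast h6

end SignProfile

/-! ### Counting in the Hamming cube -/

/-- A Chernoff bound: weighting each set by (1/2)^|S| gives total mass (3/2)^n, while sets in the
ball weigh at least r^n with r⁴ = 1/2. What remains is 3/4 ≤ r·exp(-1/10), checked in fourth powers.
-/
theorem card_hamming_ball_le (n : ℕ) :
    (((Finset.univ : Finset (Finset (Fin n))).filter fun S => 4 * S.card ≤ n).card : ℝ) ≤
      2 ^ n * Real.exp (-(n / 10)) := by
  set B := (Finset.univ : Finset (Finset (Fin n))).filter fun S => 4 * S.card ≤ n with hB
  set r : ℝ := Real.exp (-(Real.log 2 / 4)) with hr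
  have hr4 : r ^ 4 = 1 / 2 := by
    rw [hr, ← Real.exp_nat_mul]
    rw [show ((4 : ℕ) : ℝ) * -(Real.log 2 / 4) = -Real.log 2 by push_cast; ring, Real.exp_neg,
      Real.exp_log two_pos]
    norm_num
  have hr0 : 0 < r := Real.exp_pos _
  have hr1 : r ≤ 1 := Real.exp_le_one_iff.2 (by have := Real.log_pos one_lt_two; linarith)
  have h1 : (B.card : ℝ) * r ^ n ≤ (3 / 2) ^ n := by
    calc (B.card : ℝ) * r ^ n = ∑ S ∈ B, r ^ n := by rw [Finset.sum_const, nsmul_eq_mul]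
      _ ≤ ∑ S ∈ B, (1 / 2 : ℝ) ^ S.card := Finset.sum_le_sum fun S hS => by
          rw [← hr4, ← pow_mul]
          exact pow_le_pow_of_le_one hr0.le hr1 (Finset.mem_filter.1 hS).2
      _ ≤ ∑ S : Finset (Fin n), (1 / 2 : ℝ) ^ S.card :=
          Finset.sum_le_sum_of_subset_of_nonneg (Finset.subset_univ _)
            fun _ _ _ => by positivity
      _ = (3 / 2) ^ n := by
          have := Fintype.sum_pow_mul_eq_add_pow (Fin n) (1 / 2 : ℝ) 1
          simp only [one_pow, mul_one, Fintype.card_fin] at this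
          rw [this]
          norm_num
  have h2 : 3 / 4 ≤ r * Real.exp (-(1 / 10)) := by
    have h3 : (3 / 4 : ℝ) ^ 4 ≤ (r * Real.exp (-(1 / 10))) ^ 4 := by
      have h4 : (9 / 10 : ℝ) ≤ Real.exp (-(1 / 10)) := by
        have := Real.add_one_le_exp (-(1 / 10) : ℝ)
        linarith
      rw [mul_pow, hr4]
      have := pow_le_pow_left₀ (by norm_num) h4 4
      norm_num at this ⊢
      linarith
    exact (pow_le_pow_iff_left₀ (by norm_num) (by positivity) (by norm_num)).1 h3
  have h6 : (3 / 4 : ℝ) ^ n ≤ r ^ n * Real.exp (-(n / 10)) := by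
    refine (pow_le_pow_left₀ (by norm_num) h2 n).trans_eq ?_
    rw [mul_pow, ← Real.exp_nat_mul (-(1 / 10)), mul_neg, mul_one_div]
  have h7 : (3 / 2 : ℝ) ^ n = 2 ^ n * (3 / 4) ^ n := by rw [← mul_pow]; norm_num
  have h8 : (B.card : ℝ) * r ^ n ≤ 2 ^ n * Real.exp (-(n / 10)) * r ^ n := by
    rw [h7] at h1
    refine h1.trans ((mul_le_mul_of_nonneg_left h6 (by positivity)).trans_eq (by ring))
  exact le_of_mul_le_mul_right h8 (by positivity)

/-- If every point lies in few of the measurable sets indexed by a finite type, then one of the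
sets has small measure. -/
theorem exists_measure_le_of_card_le {ι Ω : Type*} [Fintype ι] [Nonempty ι] [MeasurableSpace Ω]
    (μ : Measure Ω) [IsProbabilityMeasure μ] (B : ι → Set Ω) (hB : ∀ i, MeasurableSet (B i))
    {t : ℝ}
    (hcard : ∀ ω, ∀ s : Finset ι, (∀ i ∈ s, ω ∈ B i) → (s.card : ℝ) ≤ Fintype.card ι * t) :
    ∃ i, μ (B i) ≤ ENNReal.ofReal t := by
  classical
  by_contra! hcon
  -- Double counting: the sum of the measures is the integral of the number of sets containing a
  -- point.
  have h1 : ∑ i, μ (B i) ≤ Fintype.card ι * ENNReal.ofReal t := by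
    calc ∑ i, μ (B i) = ∫⁻ ω, ∑ i, (B i).indicator 1 ω ∂μ := by
          rw [lintegral_finsetSum _ fun i _ => measurable_one.indicator (hB i)]
          simp_rw [lintegral_indicator_one (hB _)]
      _ ≤ ∫⁻ _, Fintype.card ι * ENNReal.ofReal t ∂μ := lintegral_mono fun ω => by
          have h2 := hcard ω (Finset.univ.filter fun i => ω ∈ B i) (by simp)
          have h3 : ∑ i, (B i).indicator (1 : Ω → ENNReal) ω =
              ((Finset.univ.filter fun i => ω ∈ B i).card : ENNReal) := by
            simp [Set.indicator_apply, Finset.sum_boole]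
          change ∑ i, (B i).indicator (1 : Ω → ENNReal) ω ≤ _
          rw [h3, ← ENNReal.ofReal_natCast, ← ENNReal.ofReal_natCast (Fintype.card ι),
            ← ENNReal.ofReal_mul (Nat.cast_nonneg _)]
          exact ENNReal.ofReal_le_ofReal h2
      _ = Fintype.card ι * ENNReal.ofReal t := by simp
  have h2 : ∑ _i : ι, ENNReal.ofReal t < ∑ i, μ (B i) :=
    ENNReal.sum_lt_sum_of_nonempty Finset.univ_nonempty fun i _ => hcon i
  rw [Finset.sum_const, nsmul_eq_mul, Finset.card_univ] at h2
  exact absurd h1 (not_le.2 h2)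

/-- No procedure whose input is the table of low-degree moments does well on all frames. -/
theorem SignProfile.exists_frame_measure_le {m : ℕ} (P : SignProfile m) {k d : ℕ} (hk : k ≤ m)
    (hd : 2 ≤ d) {C : ℝ} (hC0 : 0 < C) (hC : 2 ≤ P.secondCorr ^ 2 * C)
    (A : MomentTable d k → ProbabilityMeasure (Frame d)) :
    ∃ U : Frame d, (A (moments k (model P.link U)) : Measure (Frame d))
        {V | sqError (model P.link U) (model P.link V) ≤ 1 / C} ≤
      ENNReal.ofReal (Real.exp (-(1 / 20 * d))) := by
  classical
  obtain ⟨n, rfl⟩ : ∃ n, d = n + 1 := ⟨d - 1, by omega⟩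
  have hn : 1 ≤ n := by omega
  -- All sign frames share one moment table, so `ν` is the output law for every one of them.
  set ν := A (moments k (model P.link (signFrame hn ∅))) with hν
  obtain ⟨S, hS⟩ := exists_measure_le_of_card_le (ν : Measure (Frame (n + 1)))
    (fun S : Finset (Fin n) =>
      {V | sqError (model P.link (signFrame hn S)) (model P.link V) ≤ 1 / C})
    (fun S => P.measurableSet_sqError_le _ _) (t := Real.exp (-(n / 10)))
    (fun V s hs => by
      rcases s.eq_empty_or_nonempty with rfl | ⟨S₀, hS₀⟩
      · simp only [Finset.card_empty, Nat.cast_zero]; positivity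
      · have hcard : s.card ≤
            ((Finset.univ : Finset (Finset (Fin n))).filter fun S => 4 * S.card ≤ n).card := by
          -- Symmetric difference with one member S₀ carries the sets served by `V` injectively into
          -- the Hamming ball around ∅.
          refine Finset.card_le_card_of_injOn (fun S => symmDiff S₀ S) (fun S hS => ?_)
            (fun S _ S' _ h => symmDiff_right_injective S₀ h)
          simp only [Finset.coe_filter, Finset.mem_univ, true_and, Set.mem_ofPred_eq]
          exact P.four_mul_card_symmDiff_le hn hC0 hC S₀ S V (hs _ hS₀) (hs _ hS)
        rw [Fintype.card_finset, Fintype.card_fin]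
        push_cast
        exact le_trans (by exact_mod_cast hcard) (card_hamming_ball_le n))
  refine ⟨signFrame hn S, ?_⟩
  rw [P.moments_signFrame hk hn S ∅]
  refine hS.trans (ENNReal.ofReal_le_ofReal (Real.exp_le_exp.2 ?_))
  -- For n ≥ 1 one has n/10 ≥ (n + 1)/20, hence the constant 1/20 in terms of d = n + 1.
  have : (1 : ℝ) ≤ n := by exact_mod_cast hn
  push_cast
  linarith

end MIM

/-! ### Assembling both halves -/

theorem theoremF1 :
    ∃ K : ℕ, ∀ C₁ : ℕ, ∃ f : (Fin 2 → ℝ) → Bool, Measurable f ∧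
      ∃ C₀ : ℝ, 0 < C₀ ∧ ∃ c : ℝ, 0 < c ∧ ∃ d₀ : ℕ,
        ∀ C₂ : ℝ, C₀ ≤ C₂ → ∀ d : ℕ, d₀ ≤ d →
          -- no (randomized) algorithm can learn from the exact moments of degree at most `C₁`
          (∀ A : MIM.MomentTable d C₁ → ProbabilityMeasure (MIM.Frame d),
            ∃ U : MIM.Frame d,
              (A (MIM.moments C₁ (MIM.model f U)) : Measure (MIM.Frame d))
                  {V | MIM.sqError (MIM.model f U) (MIM.model f V) ≤ 1 / C₂}
                ≤ ENNReal.ofReal (Real.exp (-(c * d)))) ∧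
          -- a statistical query algorithm with `O(d²)` queries recovers the hidden matrix
          (∃ n : ℕ, n ≤ K * d ^ 2 ∧
            ∃ A : ℝ → MIM.SQAlgorithm ((Fin d → ℝ) × Bool) (Matrix (Fin 2) (Fin d) ℝ) n,
              ∀ ε : ℝ, 0 < ε → ∀ U : MIM.Frame d, ∀ a : Fin n → ℝ,
                (A ε).IsTranscript (MIM.labelledLaw (MIM.model f U)) (C₂ * d ^ 2 / ε ^ 2) a →
                  ‖(A ε).output a - U.1‖ ≤ ε) := by
  refine ⟨2, fun C₁ => ?_⟩
  -- One degree more than `C₁`, so that the first moment of σ vanishes even when `C₁ = 0`, as the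
  -- learning half requires.
  obtain ⟨P⟩ := MIM.nonempty_signProfile (C₁ + 1)
  have hc := P.secondCorr_pos
  have hA := P.amplification_pos (Nat.le_add_left 1 C₁)
  -- The two summands of the threshold serve the two halves: separation of models, then accuracy of
  -- the algorithm.
  refine ⟨P.link, P.measurable_link, 2 / P.secondCorr ^ 2 + 2 * P.amplification ^ 2,
    by positivity, 1 / 20, by norm_num, 2, fun C₂ hC₂ d hd => ⟨fun A => ?_, 2 * d, ?_,
    fun ε => P.sqAlgorithm d (Real.sqrt C₂ * d / ε), fun ε hε U a ha => ?_⟩⟩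
  · have h1 : 2 / P.secondCorr ^ 2 ≤ C₂ := le_trans (le_add_of_nonneg_right (by positivity)) hC₂
    have h0 : 0 < C₂ := lt_of_lt_of_le (by positivity) h1
    refine P.exists_frame_measure_le (Nat.le_succ C₁) hd h0 ?_ A
    rwa [div_le_iff₀' (by positivity)] at h1
  · nlinarith
  · exact P.norm_output_sub_le (Nat.le_add_left 1 C₁) (by omega)
      (le_trans (le_add_of_nonneg_left (by positivity)) hC₂) hε U ha
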